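/- **Setting.** A network has $M$ sensor nodes (set $\mathcal I_s$) and $K$ relay nodes (set $\mathcal I_r$), $\mathcal V=\mathcal I_s\cup\mathcal I_r$, with directed edge sets $\mathcal E(t)$, $t=0,1,2,\dots$, without self-loops and without relay-to-relay edges; $(j,i)\in\mathcal E(t)$ means that $j$ transmits to $i$. Let $\mathcal N_i(t)=\{j:(j,i)\in\mathcal E(t)\}$, $\mathcal N_i^s(t)=\mathcal N_i(t)\cap\mathcal I_s$, $\mathcal N_i^r(t)=\mathcal N_i(t)\cap\mathcal I_r$. With fading coefficients $h_{ij}(t)$, receiver noises $v_{ij}(t)$ and amplification factors $\alpha_j(t)$, node $i$ receives $u_i(t)=\sum_{j\in\mathcal N_i(t)}(\alpha_j(t)h_{ij}(t)x_j(t)+v_{ij}(t))$. Relays set $x_i(t)=u_i(t)$; sensors set $$x_i(t+1)=x_i(t)+a(t)\chi_i(t)\bigl(\theta+w_i(t)-x_i(t)\bigr)+a(t)\bigl(u_i(t)-b_i(t)x_i(t)\bigr),$$ where $\chi_i(t)\in\{0,1\}$ tells whether sensor $i$ has a measurement at time $t$. Let $\Gamma(t)=\mathrm{diag}(\gamma_i(t))_{i\in\mathcal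 I_s}$ with $$\gamma_i(t)=\sum_{j\in \mathcal{N}_i^s(t)} \alpha_j(t) h_{ij}(t)+\sum_{j\in \mathcal{N}_i^r(t)} \alpha_j(t) h_{ij}(t)\sum_{k\in \mathcal{N}_j^s(t)} \alpha_k(t) h_{jk}(t)-b_i(t).$$ The transmit power is $P_i(t)=\alpha_i(t)^2\,\mathbb E\{x_i(t)^2\}$ and the received power is $R_i(t)=\kappa\sum_{j\in\mathcal N_i(t)}P_j(t)$ with a constant $\kappa>0$. **Assumptions.** (1) There is an integer $B>0$ such that for every $k\ge0$ the directed graph with an edge $j\to i$ whenever the $(i,j)$ entry of $\sum_{t=kB}^{(k+1)B-1}\mathbb E\{[\mathbf 1_{(j,i)\in\mathcal E(t)}h_{ij}(t)]_{i,j}\}$ is positive is strongly connected. (2) For some $T>0$, within any $T$ consecutive steps some sensor has a measurement; the vectors $(w_i(t))_i$ are i.i.d. over $t$ with zero mean and finite variances. (3) The $h_{ij}(t)$ have means $\bar h_{ij}>0$ and finite variances and are independent across transmitters $j$ and times $t$; the $v_{ij}(t)$ have zero mean and finite variances, and the arrays $(v_{ij}(t))_{i,j}$ are independent over $t$. (4)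 The arrays $w(t),v(t),h(t)$, $t\ge0$, are mutually independent. **Parameters.** Let $d_s,d_r>0$ satisfy $d_s\ge|\mathcal N_i^s(t)|$ for all $i\in\mathcal V$ and $t$, and $d_r\ge|\mathcal N_i^r(t)|\,|\mathcal N_j^s(t)|^2$ for all $i\in\mathcal I_s$, $j\in\mathcal I_r$ and $t$. Put $\alpha_i(t)=d_s^{-1/2}$ for $i\in\mathcal I_s$, $\alpha_i(t)=d_r^{-1/2}$ for $i\in\mathcal I_r$, and $b_i(t)=\sum_{j\in\mathcal N_i(t)}b_{ij}(t)$ with $b_{ij}(t)=d_s^{-1/2}\bar h_{ij}$ for $j\in\mathcal N_i^s(t)$ and $b_{ij}(t)=(d_sd_r)^{-1/2}\bar h_{ij}\sum_{k\in\mathcal N_j^s(t)}\bar h_{jk}$ for $j\in\mathcal N_i^r(t)$. **Claim.** (i) Under Assumption (3), $\Gamma(t)$ is integrable and $\mathbb E\{\Gamma(t)\}=0$ for all $t$. (ii) Let Assumptions (1)–(4) hold, let $a(t)=t^{-\alpha}$ for $t\ge1$ with $0.5<\alpha\le1$, and $a(0)=a_0\ge0$. Let the initial sensor estimates $x_i(0)$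 be square integrable and independent of all disturbances (for instance constants), and let $\mathbb E\{h_{ij}(t)^2\}\le H$, $\mathbb E\{v_{ij}(t)^2\}\le V$, $\mathbb E\{w_i(t)^2\}\le W$, $\mathbb E\{x_i(0)^2\}\le X$ for all $i,j,t$. Let $q$ be such that at every time at which no relay receives from any sensor, each sensor receives from at most $q$ relays (if relays with nothing to forward stay silent, $q=0$; in a single network $q=K$ always works). Then every $x_i(t)$ is square integrable and there is a constant $C$, depending only on $\theta,\alpha,a_0,\kappa,d_s,d_r,H,V,W,X,q$ and not on the numbers $M$ and $K$ of sensor and relay nodes nor on anything else about the network, such that $P_i(t)\le C$ and $R_i(t)\le C$ for all nodes $i$ and all $t\ge0$. Moreover, for every $t$ and every $Q$ with $\mathbb E\{x_j(t)^2\}\le Q$ for all $j\in\mathcal I_s$, the following bounds hold: $P_i(t)\le Q/d_s$ for $i\in\mathcal I_s$; $P_i(t)\le HQ+V$ for $i\in\mathcal I_r$, if at time $t$ some sensor receives from a relay; $R_i(t)\le\kappa(Q+HQ+V)$ for all $i\in\mathcal V$. -/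

import Mathlib

open MeasureTheory ProbabilityTheory

universe u

noncomputable section

/-- The nodes of a network with `M` sensor nodes (`Sum.inl`) and `K` relay nodes (`Sum.inr`). -/
abbrev Node (M K : ℕ) : Type := Fin M ⊕ Fin K

/-- The data of a relay-assisted sensor network on a sample space `Ω`: the time-varying directed
graph, the sensors that have a measurement at each time, the fading coefficients, the receiver
noises, the measurement noises, and the initial estimates of the sensor nodes. -/
structure RelayNetwork (M K : ℕ) (Ω : Type u) [MeasurableSpace Ω] where
  /-- `(j, i) ∈ edges t` means that node `j` transmits to node `i` at time `t`. -/
  edges : ℕ → Finset (Node M K × Node M K)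
  /-- The set of sensors that have a measurement at time `t`. -/
  measuring : ℕ → Finset (Fin M)
  /-- `h t i j` is the fading coefficient of the link from `j` to `i`. -/
  h : ℕ → Node M K → Node M K → Ω → ℝ
  /-- `v t i j` is the receiver noise in the transmission from `j` to `i`. -/
  v : ℕ → Node M K → Node M K → Ω → ℝ
  /-- `w t i` is the measurement noise of sensor `i`. -/
  w : ℕ → Fin M → Ω → ℝ
  /-- The initial estimates. -/
  x₀ : Fin M → Ω → ℝ
  no_loop : ∀ t i, (i, i) ∉ edges t
  /-- Relays are one-hop: they receive data from sensors only. -/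
  no_relay_to_relay : ∀ t j k, (Sum.inr j, Sum.inr k) ∉ edges t
  measurable_h : ∀ t i j, Measurable (h t i j)
  measurable_v : ∀ t i j, Measurable (v t i j)
  measurable_w : ∀ t i, Measurable (w t i)
  measurable_x₀ : ∀ i, Measurable (x₀ i)

namespace RelayNetwork

section

variable {M K : ℕ} {Ω : Type u} [MeasurableSpace Ω] (G : RelayNetwork M K Ω)

/-! ### Neighbourhoods -/

/-- The neighbours of node `i` (the nodes it receives from) at time `t`. -/
def nbr (t : ℕ) (i : Node M K) : Finset (Node M K) :=
  Finset.univ.filter fun j => (j, i) ∈ G.edges t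

/-- The sensor neighbours of node `i`. -/
def sensorNbr (t : ℕ) (i : Node M K) : Finset (Fin M) :=
  Finset.univ.filter fun j => (Sum.inl j, i) ∈ G.edges t

/-- The relay neighbours of node `i`. -/
def relayNbr (t : ℕ) (i : Node M K) : Finset (Fin K) :=
  Finset.univ.filter fun j => (Sum.inr j, i) ∈ G.edges t

/-! ### The algorithm

`θ` is the unknown parameter, `a t` the decaying weight, `amp t i` the amplification factor of
node `i`, and `b t i` the weight of sensor `i`. -/

/-- The reception of relay `j` when the sensor estimates are `x`. -/
def relayReception (amp : ℕ → Node M K → ℝ) (t : ℕ) (x : Fin M → ℝ) (ω : Ω) (j : Fin K) : ℝ :=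
  ∑ k ∈ G.sensorNbr t (Sum.inr j),
    (amp t (Sum.inl k) * G.h t (Sum.inr j) (Sum.inl k) ω * x k
      + G.v t (Sum.inr j) (Sum.inl k) ω)

/-- The estimates of all nodes when the sensor estimates are `x`; the estimate of a relay is
its reception, which is forwarded instantaneously. -/
def nodeState (amp : ℕ → Node M K → ℝ) (t : ℕ) (x : Fin M → ℝ) (ω : Ω) : Node M K → ℝ :=
  Sum.elim x (G.relayReception amp t x ω)

/-- The data `u_i(t)` received at node `i` when the sensor estimates are `x`. -/
def received (amp : ℕ → Node M K → ℝ) (t : ℕ) (x : Fin M → ℝ) (ω : Ω) (i : Node M K) : ℝ :=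
  ∑ j ∈ G.nbr t i, (amp t j * G.h t i j ω * G.nodeState amp t x ω j + G.v t i j ω)

/-- For a relay, the estimate is the received data. -/
theorem received_inr (amp : ℕ → Node M K → ℝ) (t : ℕ) (x : Fin M → ℝ) (ω : Ω) (j : Fin K) :
    G.received amp t x ω (Sum.inr j) = G.nodeState amp t x ω (Sum.inr j) := by
  simp only [received, nodeState, nbr, relayReception, sensorNbr, Finset.sum_filter,
    Fintype.sum_sum_type, Sum.elim_inl, Sum.elim_inr]
  simp [G.no_relay_to_relay]

/-- The estimates of the sensor nodes. -/
def sensorEstimate (θ : ℝ) (a : ℕ → ℝ) (amp : ℕ → Node M K → ℝ) (b : ℕ → Fin M → ℝ) :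
    ℕ → Ω → Fin M → ℝ
  | 0, ω, i => G.x₀ i ω
  | t + 1, ω, i =>
      sensorEstimate θ a amp b t ω i
        + (if i ∈ G.measuring t then
            a t * ((θ + G.w t i ω) - sensorEstimate θ a amp b t ω i) else 0)
        + a t * (G.received amp t (sensorEstimate θ a amp b t ω) ω (Sum.inl i)
            - b t i * sensorEstimate θ a amp b t ω i)

/-- The estimate `x_i(t)` of an arbitrary node. -/
def estimate (θ : ℝ) (a : ℕ → ℝ) (amp : ℕ → Node M K → ℝ) (b : ℕ → Fin M → ℝ)
    (t : ℕ) (i : Node M K) (ω : Ω) : ℝ :=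
  G.nodeState amp t (G.sensorEstimate θ a amp b t ω) ω i

/-- The diagonal random uncertainty matrix `Γ(t)`. -/
def Gam (amp : ℕ → Node M K → ℝ) (b : ℕ → Fin M → ℝ) (t : ℕ) (ω : Ω) :
    Matrix (Fin M) (Fin M) ℝ :=
  Matrix.diagonal fun i =>
    ∑ j ∈ G.sensorNbr t (Sum.inl i), amp t (Sum.inl j) * G.h t (Sum.inl i) (Sum.inl j) ω
      + ∑ j ∈ G.relayNbr t (Sum.inl i), amp t (Sum.inr j) * G.h t (Sum.inl i) (Sum.inr j) ω *
          ∑ k ∈ G.sensorNbr t (Sum.inr j), amp t (Sum.inl k) * G.h t (Sum.inr j) (Sum.inl k) ω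
      - b t i

/-! ### Powers -/

/-- The transmit power `P_i(t) = α_i(t)² E[x_i(t)²]`. -/
def transmitPower (μ : Measure Ω) (θ : ℝ) (a : ℕ → ℝ) (amp : ℕ → Node M K → ℝ)
    (b : ℕ → Fin M → ℝ) (t : ℕ) (i : Node M K) : ℝ :=
  amp t i ^ 2 * ∫ ω, G.estimate θ a amp b t i ω ^ 2 ∂μ

/-- The received power `R_i(t)`, proportional with factor `κ` to the sum of the transmit powers
of the neighbours. -/
def receivedPower (μ : Measure Ω) (κ : ℝ) (θ : ℝ) (a : ℕ → ℝ) (amp : ℕ → Node M K → ℝ)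
    (b : ℕ → Fin M → ℝ) (t : ℕ) (i : Node M K) : ℝ :=
  κ * ∑ j ∈ G.nbr t i, G.transmitPower μ θ a amp b t j

/-! ### The design of the parameters -/

/-- The requirements on the constants `ds` and `dr` of the scaling rule. -/
structure ScalingConstants (ds dr : ℝ) : Prop where
  ds_pos : 0 < ds
  dr_pos : 0 < dr
  le_ds : ∀ t i, ((G.sensorNbr t i).card : ℝ) ≤ ds
  le_dr : ∀ t (i : Fin M) (j : Fin K),
    ((G.relayNbr t (Sum.inl i)).card : ℝ) * ((G.sensorNbr t (Sum.inr j)).card : ℝ) ^ 2 ≤ dr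

/-- The terms `b_{ij}(t)`, built from the channel means `hbar`. -/
def weightTerm (ds dr : ℝ) (hbar : Node M K → Node M K → ℝ) (t : ℕ) (i : Fin M) :
    Node M K → ℝ
  | Sum.inl j => ds ^ (-(1 / 2) : ℝ) * hbar (Sum.inl i) (Sum.inl j)
  | Sum.inr j => (ds * dr) ^ (-(1 / 2) : ℝ) * hbar (Sum.inl i) (Sum.inr j) *
      ∑ k ∈ G.sensorNbr t (Sum.inr j), hbar (Sum.inr j) (Sum.inl k)

/-- The weights `b_i(t)`. -/
def weight (ds dr : ℝ) (hbar : Node M K → Node M K → ℝ) (t : ℕ) (i : Fin M) : ℝ :=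
  ∑ j ∈ G.nbr t (Sum.inl i), G.weightTerm ds dr hbar t i j

/-! ### The standing assumptions -/

/-- The entry `(i, j)` of the sum of the expected weighted adjacency matrices over the window
`[kB, (k+1)B)`. -/
def averageAdj (μ : Measure Ω) (B k : ℕ) (i j : Node M K) : ℝ :=
  ∑ t ∈ Finset.Ico (k * B) ((k + 1) * B),
    ∫ ω, (if (j, i) ∈ G.edges t then 1 else 0) * G.h t i j ω ∂μ

/-- Joint strong connectivity on average. -/
def Assumption1 (μ : Measure Ω) : Prop :=
  ∃ B : ℕ, 0 < B ∧ ∀ k : ℕ, ∀ p q : Node M K,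
    Relation.ReflTransGen (fun j i => 0 < G.averageAdj μ B k i j) p q

/-- Within any `T` consecutive time steps some sensor has a measurement; the measurement noise
vectors are i.i.d. over time, with zero mean and finite variance (they may be correlated across
the sensors). -/
structure Assumption2 (μ : Measure Ω) : Prop where
  measurements : ∃ T : ℕ, 0 < T ∧ ∀ t, ∃ s, t ≤ s ∧ s < t + T ∧ (G.measuring s).Nonempty
  indep : iIndepFun (fun (t : ℕ) (ω : Ω) (i : Fin M) => G.w t i ω) μ
  identDistrib : ∀ t, IdentDistrib (fun (ω : Ω) (i : Fin M) => G.w t i ω)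
    (fun (ω : Ω) (i : Fin M) => G.w 0 i ω) μ μ
  memLp : ∀ t i, MemLp (G.w t i) 2 μ
  mean : ∀ t i, ∫ ω, G.w t i ω ∂μ = 0

/-- The fading coefficients have positive means `hbar i j` and finite variances, and are
independent across transmitters and time steps; the receiver noises have zero mean and finite
variance, and are independent over time. -/
structure Assumption3 (μ : Measure Ω) (hbar : Node M K → Node M K → ℝ) : Prop where
  memLp_h : ∀ t i j, MemLp (G.h t i j) 2 μ
  mean_h : ∀ t i j, ∫ ω, G.h t i j ω ∂μ = hbar i j
  hbar_pos : ∀ i j, 0 < hbar i j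
  indep_h : iIndepFun (fun (p : ℕ × Node M K) (ω : Ω) (i : Node M K) => G.h p.1 i p.2 ω) μ
  memLp_v : ∀ t i j, MemLp (G.v t i j) 2 μ
  mean_v : ∀ t i j, ∫ ω, G.v t i j ω ∂μ = 0
  indep_v : iIndepFun (fun (t : ℕ) (ω : Ω) (i j : Node M K) => G.v t i j ω) μ

/-- All disturbances at time `t`: measurement noises, receiver noises, fading coefficients. -/
def disturbance (t : ℕ) (ω : Ω) :
    (Fin M → ℝ) × (Node M K → Node M K → ℝ) × (Node M K → Node M K → ℝ) :=
  (fun i => G.w t i ω, fun i j => G.v t i j ω, fun i j => G.h t i j ω)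

/-- The random arrays `w(t)`, `v(t)`, `h(t)`, `t ≥ 0`, are mutually independent: the triples
`(w(t), v(t), h(t))` are mutually independent over `t`, and for each `t` the three entries are
mutually independent. -/
structure Assumption4 (μ : Measure Ω) : Prop where
  over_time : iIndepFun (fun t => G.disturbance t) μ
  w_vh : ∀ t, IndepFun (fun ω => (G.disturbance t ω).1) (fun ω => (G.disturbance t ω).2) μ
  v_h : ∀ t, IndepFun (fun ω => (G.disturbance t ω).2.1) (fun ω => (G.disturbance t ω).2.2) μ

/-- The initial estimates (for instance, constants) are square integrable and independent of
all disturbances. -/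
structure AdmissibleInit (μ : Measure Ω) : Prop where
  memLp : ∀ i, MemLp (G.x₀ i) 2 μ
  indep : IndepFun (fun (ω : Ω) (i : Fin M) => G.x₀ i ω) (fun (ω : Ω) (t : ℕ) => G.disturbance t ω) μ

/-- Common bounds `H`, `V`, `W`, `X` on the second moments of the fading coefficients, receiver
noises, measurement noises and initial estimates. -/
structure MomentBounds (μ : Measure Ω) (H V W X : ℝ) : Prop where
  h_le : ∀ t i j, ∫ ω, G.h t i j ω ^ 2 ∂μ ≤ H
  v_le : ∀ t i j, ∫ ω, G.v t i j ω ^ 2 ∂μ ≤ V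
  w_le : ∀ t i, ∫ ω, G.w t i ω ^ 2 ∂μ ≤ W
  x₀_le : ∀ i, ∫ ω, G.x₀ i ω ^ 2 ∂μ ≤ X

/-- At any time at which no relay receives from a sensor, so that relays have nothing to forward,
each sensor still listens to at most `q` relays. (At all other times the number of relays that a
sensor listens to is at most `dr`.) In a single network this holds with `q = K`. -/
def IdleRelayBound (q : ℕ) : Prop :=
  ∀ t, (∀ j : Fin K, G.sensorNbr t (Sum.inr j) = ∅) →
    ∀ i : Fin M, (G.relayNbr t (Sum.inl i)).card ≤ q

end

end RelayNetwork

/-- The scaling rule: `ds ^ (-1/2)` for sensors and `dr ^ (-1/2)` for relays. -/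
def scalingRule (M K : ℕ) (ds dr : ℝ) (_t : ℕ) : Node M K → ℝ
  | Sum.inl _ => ds ^ (-(1 / 2) : ℝ)
  | Sum.inr _ => dr ^ (-(1 / 2) : ℝ)

/-- The decaying weight `a(t) = t ^ (-α)` for `t ≥ 1`, with an arbitrary value `a₀` at `t = 0`,
where `t ^ (-α)` is undefined. -/
def powerWeight (a₀ α : ℝ) (t : ℕ) : ℝ :=
  if t = 0 then a₀ else (t : ℝ) ^ (-α)

end

/-!
The choice of `b` makes `E Γ = 0`: in the mean, a sensor estimate moves towards `θ` and towards
the other sensor estimates, so for small steps its conditional mean given the past is a convex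
combination of `θ` and current sensor estimates, and its `L²` norm does not grow. What remains
of a step is centred given the past, so it only adds its own variance, which is `O(a(t)²)` times
the largest second moment. Hence the second moments grow in one step by a factor of at most
`1 + O(a(t)²)`, and the product of these factors converges because `∑ a(t)²` does.

No constant depends on the number of nodes: a sum of `n` signals has a second moment of at most
`n` times the sum of theirs, a node hears at most `ds + dr + q` others, and the powers `1 / ds`
and `1 / dr` of the scaling factors make up for the number of sensors heard directly and for the
squared numbers of sensors heard through relays.
-/

section Independence

variable {Ω E F G : Type*} [MeasurableSpace Ω] [MeasurableSpace E] [MeasurableSpace F]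
  [MeasurableSpace G] {μ : Measure Ω} {X : Ω → E} {Y : Ω → F} {Z : Ω → G}

theorem indepFun_prodMk_left_of_indepFun_prodMk_right [IsProbabilityMeasure μ]
    (hX : Measurable X) (hY : Measurable Y) (hZ : Measurable Z)
    (h : IndepFun X (fun ω => (Y ω, Z ω)) μ) (hYZ : IndepFun Y Z μ) :
    IndepFun (fun ω => (X ω, Y ω)) Z μ := by
  have hXY : IndepFun X Y μ := h.comp measurable_id measurable_fst
  have := Measure.isProbabilityMeasure_map (μ := μ) hX.aemeasurable
  have := Measure.isProbabilityMeasure_map (μ := μ) hY.aemeasurable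
  have := Measure.isProbabilityMeasure_map (μ := μ) hZ.aemeasurable
  rw [indepFun_iff_map_prod_eq_prod_map_map (by fun_prop) (by fun_prop)] at h hXY hYZ ⊢
  rw [hXY, ← MeasurableEquiv.prodAssoc.map_measurableEquiv_injective.eq_iff,
    Measure.prodAssoc_prod, ← hYZ, ← h,
    Measure.map_map MeasurableEquiv.prodAssoc.measurable (by fun_prop)]
  rfl

end Independence

section SecondMoments

variable {Ω : Type*} [MeasurableSpace Ω] {μ : Measure Ω} {f g g' : Ω → ℝ}

theorem integral_sum_sq_le_card_mul_sum {ι : Type*} (s : Finset ι) {f : ι → Ω → ℝ}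
    (hf : ∀ i ∈ s, MemLp (f i) 2 μ) :
    ∫ ω, (∑ i ∈ s, f i ω) ^ 2 ∂μ ≤ s.card * ∑ i ∈ s, ∫ ω, f i ω ^ 2 ∂μ := by
  rw [← integral_finsetSum s fun i hi => (hf i hi).integrable_sq, ← integral_const_mul]
  exact integral_mono (memLp_finsetSum s hf).integrable_sq
    ((integrable_finsetSum s fun i hi => (hf i hi).integrable_sq).const_mul _)
    fun _ => sq_sum_le_card_mul_sum_sq

theorem integral_add_sq (hf : MemLp f 2 μ) (hg : MemLp g 2 μ) :
    ∫ ω, (f ω + g ω) ^ 2 ∂μ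
      = ∫ ω, f ω ^ 2 ∂μ + 2 * ∫ ω, f ω * g ω ∂μ + ∫ ω, g ω ^ 2 ∂μ := by
  have hfg : Integrable (fun ω => 2 * (f ω * g ω)) μ := (hf.integrable_mul hg).const_mul 2
  have hsum : Integrable (fun ω => f ω ^ 2 + 2 * (f ω * g ω)) μ := hf.integrable_sq.add hfg
  rw [← integral_const_mul, ← integral_add hf.integrable_sq hfg,
    ← integral_add hsum hg.integrable_sq]
  exact integral_congr_ae (.of_forall fun ω => by ring)

theorem integral_add_sq_le (hf : MemLp f 2 μ) (hg : MemLp g 2 μ) :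
    ∫ ω, (f ω + g ω) ^ 2 ∂μ ≤ 2 * (∫ ω, f ω ^ 2 ∂μ + ∫ ω, g ω ^ 2 ∂μ) := by
  rw [← integral_add hf.integrable_sq hg.integrable_sq, ← integral_const_mul]
  exact integral_mono (hf.add hg).integrable_sq
    ((hf.integrable_sq.add hg.integrable_sq).const_mul _) fun _ => add_sq_le

theorem integral_add_mul_sq_le (hf : MemLp f 2 μ) (hg : MemLp g 2 μ) (hg' : MemLp g' 2 μ)
    (h : ∫ ω, f ω * g ω ∂μ = ∫ ω, f ω * g' ω ∂μ) (a : ℝ) :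
    ∫ ω, (f ω + a * g ω) ^ 2 ∂μ
      ≤ ∫ ω, (f ω + a * g' ω) ^ 2 ∂μ + a ^ 2 * ∫ ω, g ω ^ 2 ∂μ := by
  have hnonneg : 0 ≤ a ^ 2 * ∫ ω, g' ω ^ 2 ∂μ :=
    mul_nonneg (sq_nonneg a) (integral_nonneg fun _ => sq_nonneg _)
  rw [integral_add_sq hf (hg.const_mul a), integral_add_sq hf (hg'.const_mul a)]
  simp only [mul_pow, mul_left_comm _ a, integral_const_mul, h]
  linarith

theorem sq_integral_le_integral_sq [IsProbabilityMeasure μ] (hf : MemLp f 2 μ) :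
    (∫ ω, f ω ∂μ) ^ 2 ≤ ∫ ω, f ω ^ 2 ∂μ :=
  sub_nonneg.1 (variance_eq_sub hf ▸ variance_nonneg f μ)

theorem integral_add_sq_of_indepFun (hf : MemLp f 2 μ) (hg : MemLp g 2 μ) (h : IndepFun f g μ)
    (hg0 : ∫ ω, g ω ∂μ = 0) :
    ∫ ω, (f ω + g ω) ^ 2 ∂μ = ∫ ω, f ω ^ 2 ∂μ + ∫ ω, g ω ^ 2 ∂μ := by
  rw [integral_add_sq hf hg,
    h.integral_fun_mul_eq_mul_integral hf.aestronglyMeasurable hg.aestronglyMeasurable, hg0]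
  ring

theorem indepFun_sq_sq (h : IndepFun f g μ) : IndepFun (fun ω => f ω ^ 2) (fun ω => g ω ^ 2) μ :=
  h.comp (measurable_id.pow_const 2) (measurable_id.pow_const 2)

theorem memLp_two_mul_of_indepFun (hf : MemLp f 2 μ) (hg : MemLp g 2 μ) (h : IndepFun f g μ) :
    MemLp (fun ω => f ω * g ω) 2 μ := by
  have hsq : Integrable (fun ω => f ω ^ 2 * g ω ^ 2) μ :=
    (indepFun_sq_sq h).integrable_mul hf.integrable_sq hg.integrable_sq
  refine (memLp_two_iff_integrable_sq (hf.aestronglyMeasurable.mul hg.aestronglyMeasurable)).2 ?_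
  simpa only [Pi.mul_apply, mul_pow] using hsq

theorem integral_mul_sq_of_indepFun (hf : MemLp f 2 μ) (hg : MemLp g 2 μ) (h : IndepFun f g μ) :
    ∫ ω, (f ω * g ω) ^ 2 ∂μ = (∫ ω, f ω ^ 2 ∂μ) * ∫ ω, g ω ^ 2 ∂μ := by
  simp only [mul_pow]
  exact (indepFun_sq_sq h).integral_fun_mul_eq_mul_integral
    hf.integrable_sq.aestronglyMeasurable hg.integrable_sq.aestronglyMeasurable

theorem lpNorm_two_sq (hf : AEStronglyMeasurable f μ) :
    lpNorm f 2 μ ^ 2 = ∫ ω, f ω ^ 2 ∂μ := by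
  have hnonneg : 0 ≤ ∫ ω, f ω ^ 2 ∂μ := integral_nonneg fun _ => sq_nonneg _
  rw [lpNorm_eq_integral_norm_rpow_toReal two_ne_zero ENNReal.ofNat_ne_top hf]
  simp only [ENNReal.toReal_ofNat, Real.rpow_ofNat, Real.norm_eq_abs, sq_abs]
  rw [← one_div, ← Real.sqrt_eq_rpow, Real.sq_sqrt hnonneg]

theorem lpNorm_two_le_iff (hf : AEStronglyMeasurable f μ) {r : ℝ} (hr : 0 ≤ r) :
    lpNorm f 2 μ ≤ r ↔ ∫ ω, f ω ^ 2 ∂μ ≤ r ^ 2 := by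
  rw [← lpNorm_two_sq hf, sq_le_sq₀ lpNorm_nonneg hr]

theorem lpNorm_const_mul (c : ℝ) (f : Ω → ℝ) (p : ENNReal) (μ : Measure Ω) :
    lpNorm (fun ω => c * f ω) p μ = |c| * lpNorm f p μ :=
  lpNorm_const_smul c f μ

theorem lpNorm_sum_const_mul_le {ι : Type*} (s : Finset ι) {c : ι → ℝ} (hc : ∀ i ∈ s, 0 ≤ c i)
    {p : ENNReal} (hp : 1 ≤ p) {f : ι → Ω → ℝ} (hf : ∀ i ∈ s, MemLp (f i) p μ) {m : ι → ℝ}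
    (hm : ∀ i ∈ s, lpNorm (f i) p μ ≤ m i) :
    lpNorm (fun ω => ∑ i ∈ s, c i * f i ω) p μ ≤ ∑ i ∈ s, c i * m i := by
  rw [← Finset.sum_fn]
  refine (lpNorm_sum_le (fun i hi => (hf i hi).const_mul (c i)) hp).trans
    (Finset.sum_le_sum fun i hi => ?_)
  rw [lpNorm_const_mul, abs_of_nonneg (hc i hi)]
  exact mul_le_mul_of_nonneg_left (hm i hi) (hc i hi)

end SecondMoments

section Weights

theorem sq_abs_one_sub_add_le (s : ℝ) : (|1 - s| + s) ^ 2 ≤ 1 + 4 * s ^ 2 := by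
  rcases le_total s 1 with h | h
  · rw [abs_of_nonneg (sub_nonneg.2 h)]
    nlinarith
  · rw [abs_of_nonpos (sub_nonpos.2 h)]
    nlinarith

theorem rpow_neg_half_sq {d : ℝ} (hd : 0 ≤ d) : (d ^ (-(1 / 2) : ℝ)) ^ 2 = d⁻¹ := by
  rw [← Real.rpow_natCast, ← Real.rpow_mul hd, ← Real.rpow_neg_one]
  norm_num

theorem powerWeight_nonneg {a₀ : ℝ} (h : 0 ≤ a₀) (α : ℝ) (t : ℕ) : 0 ≤ powerWeight a₀ α t := by
  unfold powerWeight
  split_ifs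
  · exact h
  · positivity

theorem summable_powerWeight_sq (a₀ : ℝ) {α : ℝ} (h : 1 / 2 < α) :
    Summable fun t => powerWeight a₀ α t ^ 2 := by
  have hs : Summable fun t : ℕ => (t : ℝ) ^ (-α * 2) := Real.summable_nat_rpow.2 (by linarith)
  rw [← summable_nat_add_iff 1] at hs ⊢
  refine hs.congr fun t => ?_
  rw [powerWeight, if_neg t.succ_ne_zero, Real.rpow_mul (Nat.cast_nonneg _), Real.rpow_ofNat]

end Weights

namespace RelayNetwork

section Neighbours

variable {M K : ℕ} {Ω : Type u} [MeasurableSpace Ω] (G : RelayNetwork M K Ω)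

theorem sum_nbr (t : ℕ) (i : Node M K) (f : Node M K → ℝ) :
    ∑ j ∈ G.nbr t i, f j
      = ∑ j ∈ G.sensorNbr t i, f (Sum.inl j) + ∑ j ∈ G.relayNbr t i, f (Sum.inr j) := by
  simp only [nbr, sensorNbr, relayNbr, Finset.sum_filter, Fintype.sum_sum_type]

theorem card_nbr (t : ℕ) (i : Node M K) :
    ((G.nbr t i).card : ℝ) = (G.sensorNbr t i).card + (G.relayNbr t i).card := by
  simpa using G.sum_nbr t i fun _ => 1

theorem relayNbr_inr (t : ℕ) (j : Fin K) : G.relayNbr t (Sum.inr j) = ∅ := by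
  simp [relayNbr, G.no_relay_to_relay]

variable {G}

theorem exists_inl_of_mem_nbr_inr {t : ℕ} {j : Fin K} {i : Node M K}
    (hi : i ∈ G.nbr t (Sum.inr j)) : ∃ k, i = Sum.inl k := by
  obtain k | k := i
  · exact ⟨k, rfl⟩
  · simp [nbr, G.no_relay_to_relay] at hi

variable {ds dr : ℝ}

theorem ScalingConstants.one_le_ds (hG : G.ScalingConstants ds dr) {t : ℕ} {i : Node M K}
    (hi : (G.sensorNbr t i).Nonempty) : 1 ≤ ds :=
  le_trans (by exact_mod_cast hi.card_pos) (hG.le_ds t i)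

theorem ScalingConstants.card_sensorNbr_sq_le (hG : G.ScalingConstants ds dr) {t : ℕ} {i : Fin M}
    (hi : (G.relayNbr t (Sum.inl i)).Nonempty) (j : Fin K) :
    ((G.sensorNbr t (Sum.inr j)).card : ℝ) ^ 2 ≤ dr :=
  (le_mul_of_one_le_left (sq_nonneg _) (by exact_mod_cast hi.card_pos)).trans (hG.le_dr t i j)

theorem ScalingConstants.sum_card_sensorNbr_sq_le (hG : G.ScalingConstants ds dr) (t : ℕ)
    (i : Node M K) :
    ∑ j ∈ G.relayNbr t i, ((G.sensorNbr t (Sum.inr j)).card : ℝ) ^ 2 ≤ dr := by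
  obtain h | h := (G.relayNbr t i).eq_empty_or_nonempty
  · rw [h, Finset.sum_empty]
    exact hG.dr_pos.le
  obtain i | i := i
  · have hpos : (0 : ℝ) < (G.relayNbr t (Sum.inl i)).card := by exact_mod_cast h.card_pos
    have hterm : ∀ j ∈ G.relayNbr t (Sum.inl i), ((G.sensorNbr t (Sum.inr j)).card : ℝ) ^ 2
        ≤ dr / (G.relayNbr t (Sum.inl i)).card := fun j _ =>
      (le_div_iff₀' hpos).2 (hG.le_dr t i j)
    refine (Finset.sum_le_card_nsmul _ _ _ hterm).trans_eq ?_
    rw [nsmul_eq_mul, mul_div_cancel₀ _ hpos.ne']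
  · exact absurd (G.relayNbr_inr t i) h.ne_empty

theorem ScalingConstants.card_relayNbr_le (hG : G.ScalingConstants ds dr) {q : ℕ}
    (hq : G.IdleRelayBound q) (t : ℕ) (i : Node M K) :
    ((G.relayNbr t i).card : ℝ) ≤ dr + q := by
  have hdr := hG.dr_pos
  obtain i | i := i
  · by_cases h : ∀ j : Fin K, G.sensorNbr t (Sum.inr j) = ∅
    · exact le_add_of_nonneg_of_le hdr.le (by exact_mod_cast hq t h i)
    · push Not at h
      obtain ⟨j, hj⟩ := h
      have hone : (1 : ℝ) ≤ (G.sensorNbr t (Sum.inr j)).card := by exact_mod_cast hj.card_pos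
      exact le_add_of_le_of_nonneg
        ((le_mul_of_one_le_right (Nat.cast_nonneg _) (one_le_pow₀ hone)).trans (hG.le_dr t i j))
        (Nat.cast_nonneg q)
  · rw [relayNbr_inr, Finset.card_empty, Nat.cast_zero]
    positivity

theorem ScalingConstants.card_nbr_le (hG : G.ScalingConstants ds dr) {q : ℕ}
    (hq : G.IdleRelayBound q) (t : ℕ) (i : Node M K) :
    ((G.nbr t i).card : ℝ) ≤ ds + dr + q := by
  rw [card_nbr]
  linarith [hG.le_ds t i, hG.card_relayNbr_le hq t i]

end Neighbours

section MeanReception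

variable {M K : ℕ} {Ω : Type u} [MeasurableSpace Ω] (G : RelayNetwork M K Ω)
  (amp : ℕ → Node M K → ℝ) (hbar : Node M K → Node M K → ℝ) (t : ℕ) (x : Fin M → ℝ)

/-- The states of all nodes when the sensor estimates are `x`, all fading coefficients are replaced
by their means `hbar`, and the receiver noises by `0`. -/
def meanState : Node M K → ℝ :=
  Sum.elim x fun j =>
    ∑ k ∈ G.sensorNbr t (Sum.inr j), amp t (Sum.inl k) * hbar (Sum.inr j) (Sum.inl k) * x k

/-- The expected reception of node `i` when the sensor estimates are `x`: the data received when
all fading coefficients are replaced by their means `hbar`, and the receiver noises by `0`. -/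
def meanReceived (i : Node M K) : ℝ :=
  ∑ j ∈ G.nbr t i, amp t j * hbar i j * G.meanState amp hbar t x j

theorem meanReceived_inr (j : Fin K) :
    G.meanReceived amp hbar t x (Sum.inr j) = G.meanState amp hbar t x (Sum.inr j) := by
  rw [meanReceived, sum_nbr, relayNbr_inr, Finset.sum_empty, add_zero]
  rfl

variable {G amp hbar t x}

theorem meanState_nonneg (hamp : ∀ j, 0 ≤ amp t j) (hbar_nonneg : ∀ i j, 0 ≤ hbar i j)
    (hx : ∀ k, 0 ≤ x k) (j : Node M K) : 0 ≤ G.meanState amp hbar t x j := by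
  obtain j | j := j
  · exact hx j
  · simp only [meanState, Sum.elim_inr]
    exact Finset.sum_nonneg fun k _ =>
      mul_nonneg (mul_nonneg (hamp (Sum.inl k)) (hbar_nonneg (Sum.inr j) (Sum.inl k))) (hx k)

theorem meanReceived_nonneg (hamp : ∀ j, 0 ≤ amp t j) (hbar_nonneg : ∀ i j, 0 ≤ hbar i j)
    (hx : ∀ k, 0 ≤ x k) (i : Node M K) : 0 ≤ G.meanReceived amp hbar t x i :=
  Finset.sum_nonneg fun j _ => mul_nonneg (mul_nonneg (hamp j) (hbar_nonneg i j))
    (meanState_nonneg hamp hbar_nonneg hx j)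

theorem scalingRule_nonneg {ds dr : ℝ} (hds : 0 ≤ ds) (hdr : 0 ≤ dr) (t : ℕ) (j : Node M K) :
    0 ≤ scalingRule M K ds dr t j := by
  obtain _ | _ := j
  · exact Real.rpow_nonneg hds _
  · exact Real.rpow_nonneg hdr _

theorem weight_eq_meanReceived_one {ds dr : ℝ} (hds : 0 ≤ ds) (hdr : 0 ≤ dr) (i : Fin M) :
    G.weight ds dr hbar t i
      = G.meanReceived (scalingRule M K ds dr) hbar t 1 (Sum.inl i) := by
  refine Finset.sum_congr rfl fun j _ => ?_
  obtain j | j := j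
  · exact (mul_one _).symm
  · simp only [weightTerm, meanState, scalingRule, Sum.elim_inr, Pi.one_apply, mul_one,
      Real.mul_rpow hds hdr, ← Finset.mul_sum]
    ring

end MeanReception

section Gam

variable {M K : ℕ} {Ω : Type u} [MeasurableSpace Ω] {G : RelayNetwork M K Ω} {μ : Measure Ω}
  {hbar : Node M K → Node M K → ℝ}

theorem Assumption3.indepFun_columns_column (h3 : G.Assumption3 μ hbar) (t : ℕ) (j : Node M K) :
    IndepFun (fun ω (k : (Finset.univ.erase j : Finset (Node M K))) i => G.h t i k ω)
      (fun ω i => G.h t i j ω) μ := by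
  have hcol : iIndepFun (fun (k : Node M K) ω i => G.h t i k ω) μ :=
    h3.indep_h.precomp (g := Prod.mk t) (Prod.mk_right_injective t)
  exact (hcol.indepFun_finset (Finset.univ.erase j) {j} (by simp)
    fun k => measurable_pi_lambda _ fun i => G.measurable_h t i k).comp measurable_id
    (measurable_pi_apply (⟨j, Finset.mem_singleton_self j⟩ : ({j} : Finset (Node M K))))

theorem Assumption3.indepFun_relayGain (h3 : G.Assumption3 μ hbar) (amp : ℕ → Node M K → ℝ)
    (t : ℕ) (i : Node M K) (j : Fin K) :
    IndepFun (G.h t i (Sum.inr j)) (fun ω => ∑ k ∈ G.sensorNbr t (Sum.inr j),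
      amp t (Sum.inl k) * G.h t (Sum.inr j) (Sum.inl k) ω) μ := by
  let e (k : Fin M) : (Finset.univ.erase (Sum.inr j) : Finset (Node M K)) := ⟨Sum.inl k, by simp⟩
  exact ((h3.indepFun_columns_column t (Sum.inr j)).comp
    (φ := fun c => ∑ k ∈ G.sensorNbr t (Sum.inr j), amp t (Sum.inl k) * c (e k) (Sum.inr j))
    (by fun_prop) (measurable_pi_apply i)).symm

variable [IsProbabilityMeasure μ]

theorem Assumption3.integrable_h (h3 : G.Assumption3 μ hbar) (t : ℕ) (i j : Node M K) :
    Integrable (G.h t i j) μ :=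
  (h3.memLp_h t i j).integrable one_le_two

variable (amp : ℕ → Node M K → ℝ)

theorem Assumption3.integrable_gain (h3 : G.Assumption3 μ hbar) (t : ℕ) (i : Node M K)
    (s : Finset (Fin M)) :
    Integrable (fun ω => ∑ k ∈ s, amp t (Sum.inl k) * G.h t i (Sum.inl k) ω) μ :=
  integrable_finsetSum _ fun _ _ => (h3.integrable_h ..).const_mul _

theorem Assumption3.integral_gain (h3 : G.Assumption3 μ hbar) (t : ℕ) (i : Node M K)
    (s : Finset (Fin M)) :
    ∫ ω, ∑ k ∈ s, amp t (Sum.inl k) * G.h t i (Sum.inl k) ω ∂μ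
      = ∑ k ∈ s, amp t (Sum.inl k) * hbar i (Sum.inl k) := by
  rw [integral_finsetSum _ fun _ _ => (h3.integrable_h ..).const_mul _]
  simp only [integral_const_mul, h3.mean_h]

theorem Assumption3.integrable_relayGain (h3 : G.Assumption3 μ hbar) (t : ℕ) (i : Node M K)
    (j : Fin K) :
    Integrable (fun ω => amp t (Sum.inr j) * G.h t i (Sum.inr j) ω *
      ∑ k ∈ G.sensorNbr t (Sum.inr j), amp t (Sum.inl k) * G.h t (Sum.inr j) (Sum.inl k) ω) μ := by
  simp only [mul_assoc (amp t (Sum.inr j))]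
  exact ((h3.indepFun_relayGain amp t i j).integrable_mul (h3.integrable_h ..)
    (h3.integrable_gain amp t _ _)).const_mul _

theorem Assumption3.integral_relayGain (h3 : G.Assumption3 μ hbar) (t : ℕ) (i : Node M K)
    (j : Fin K) :
    ∫ ω, amp t (Sum.inr j) * G.h t i (Sum.inr j) ω *
      ∑ k ∈ G.sensorNbr t (Sum.inr j), amp t (Sum.inl k) * G.h t (Sum.inr j) (Sum.inl k) ω ∂μ
      = amp t (Sum.inr j) * hbar i (Sum.inr j) * G.meanState amp hbar t 1 (Sum.inr j) := by
  simp only [mul_assoc (amp t (Sum.inr j)), integral_const_mul]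
  rw [(h3.indepFun_relayGain amp t i j).integral_fun_mul_eq_mul_integral
    (h3.integrable_h ..).aestronglyMeasurable (h3.integrable_gain amp t _ _).aestronglyMeasurable,
    h3.mean_h, h3.integral_gain]
  simp only [meanState, Sum.elim_inr, Pi.one_apply, mul_one]

theorem Assumption3.integrable_and_integral_Gam_diag (h3 : G.Assumption3 μ hbar)
    (b : ℕ → Fin M → ℝ) (t : ℕ) (i : Fin M) :
    Integrable (fun ω => G.Gam amp b t ω i i) μ ∧
      ∫ ω, G.Gam amp b t ω i i ∂μ
        = G.meanReceived amp hbar t 1 (Sum.inl i) - b t i := by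
  have hsensor := h3.integrable_gain amp t (Sum.inl i) (G.sensorNbr t (Sum.inl i))
  have hrelay := integrable_finsetSum (G.relayNbr t (Sum.inl i)) fun j _ =>
    h3.integrable_relayGain amp t (Sum.inl i) j
  simp only [Gam, Matrix.diagonal_apply_eq]
  refine ⟨(hsensor.add hrelay).sub (integrable_const _), ?_⟩
  refine (integral_sub (hsensor.add hrelay) (integrable_const _)).trans ?_
  rw [integral_add' hsensor hrelay,
    integral_finsetSum _ fun j _ => h3.integrable_relayGain amp t (Sum.inl i) j,
    h3.integral_gain, integral_const, probReal_univ, one_smul]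
  simp only [h3.integral_relayGain, meanReceived, sum_nbr, meanState, Sum.elim_inl, Pi.one_apply,
    mul_one]

theorem Assumption3.integrable_and_integral_Gam_scalingRule (h3 : G.Assumption3 μ hbar)
    {ds dr : ℝ} (hds : 0 ≤ ds) (hdr : 0 ≤ dr) (t : ℕ) (i j : Fin M) :
    Integrable (fun ω => G.Gam (scalingRule M K ds dr) (G.weight ds dr hbar) t ω i j) μ ∧
      ∫ ω, G.Gam (scalingRule M K ds dr) (G.weight ds dr hbar) t ω i j ∂μ = 0 := by
  obtain rfl | hij := eq_or_ne i j
  · have hmean := h3.integrable_and_integral_Gam_diag (scalingRule M K ds dr)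
      (G.weight ds dr hbar) t i
    rwa [weight_eq_meanReceived_one hds hdr, sub_self] at hmean
  · simp only [Gam, Matrix.diagonal_apply_ne _ hij, integral_zero]
    exact ⟨integrable_zero .., trivial⟩

end Gam

section Measurability

variable {M K : ℕ} {Ω : Type u} [MeasurableSpace Ω] {G : RelayNetwork M K Ω} {t : ℕ}

theorem measurable_disturbance (G : RelayNetwork M K Ω) (t : ℕ) : Measurable (G.disturbance t) :=
  (measurable_pi_lambda _ fun i => G.measurable_w t i).prodMk
    ((measurable_pi_lambda _ fun i => measurable_pi_lambda _ fun j => G.measurable_v t i j).prodMk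
      (measurable_pi_lambda _ fun i => measurable_pi_lambda _ fun j => G.measurable_h t i j))

-- `β` will be `Ω` with the σ-algebra generated by the past of the network, and `ι` the identity.
variable {β : Type*} {mβ : MeasurableSpace β} {ι : β → Ω} {x : β → Fin M → ℝ}

theorem measurable_received (amp : ℕ → Node M K → ℝ) (hx : Measurable x)
    (hD : Measurable fun z => G.disturbance t (ι z)) (i : Node M K) :
    Measurable fun z => G.received amp t (x z) (ι z) i := by
  have hh (i j : Node M K) : Measurable fun z => G.h t i j (ι z) := hD.snd.snd.eval.eval
  have hv (i j : Node M K) : Measurable fun z => G.v t i j (ι z) := hD.snd.fst.eval.eval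
  have hstate : ∀ j, Measurable fun z => G.nodeState amp t (x z) (ι z) j
    | Sum.inl k => hx.eval
    | Sum.inr j => Finset.measurable_fun_sum (G.sensorNbr t (Sum.inr j)) fun k _ =>
        (((hh (Sum.inr j) (Sum.inl k)).const_mul (amp t (Sum.inl k))).mul hx.eval).add
          (hv (Sum.inr j) (Sum.inl k))
  exact Finset.measurable_fun_sum _ fun j _ => (((hh ..).const_mul _).mul (hstate j)).add (hv ..)

theorem measurable_sensorEstimate (θ : ℝ) (a : ℕ → ℝ) (amp : ℕ → Node M K → ℝ)
    (b : ℕ → Fin M → ℝ) (hx₀ : Measurable fun z i => G.x₀ i (ι z))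
    (hD : ∀ s < t, Measurable fun z => G.disturbance s (ι z)) :
    Measurable fun z => G.sensorEstimate θ a amp b t (ι z) := by
  induction t with
  | zero => exact hx₀
  | succ t ih =>
    have hx := ih fun s hs => hD s (hs.trans t.lt_succ_self)
    have hDt := hD t t.lt_succ_self
    refine measurable_pi_lambda _ fun i => (hx.eval.add ?_).add
      (((measurable_received amp hx hDt _).sub (hx.eval.const_mul _)).const_mul _)
    split_ifs
    · exact ((hDt.fst.eval.const_add θ).sub hx.eval).const_mul _
    · exact measurable_const

end Measurability

/-- Square integrable sensor estimates at time `t` that do not depend on the disturbances at time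
`t`. These are the properties of the estimates of the algorithm that control its next step. -/
structure Nonanticipating {M K : ℕ} {Ω : Type u} [MeasurableSpace Ω] (G : RelayNetwork M K Ω)
    (μ : Measure Ω) (t : ℕ) (x : Ω → Fin M → ℝ) : Prop where
  measurable : Measurable x
  memLp : ∀ k, MemLp (fun ω => x ω k) 2 μ
  indep : IndepFun x (G.disturbance t) μ

namespace Nonanticipating

variable {M K : ℕ} {Ω : Type u} [MeasurableSpace Ω] {G : RelayNetwork M K Ω} {μ : Measure Ω}
  {hbar : Node M K → Node M K → ℝ} {t : ℕ} {x : Ω → Fin M → ℝ} {φ : (Fin M → ℝ) → ℝ}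

theorem memLp_meanState (hx : G.Nonanticipating μ t x) (amp : ℕ → Node M K → ℝ)
    (hbar : Node M K → Node M K → ℝ) (i : Node M K) :
    MemLp (fun ω => G.meanState amp hbar t (x ω) i) 2 μ := by
  obtain k | j := i
  · exact hx.memLp k
  · exact memLp_finsetSum (G.sensorNbr t (Sum.inr j)) fun k _ => (hx.memLp k).const_mul _

theorem memLp_meanReceived (hx : G.Nonanticipating μ t x) (amp : ℕ → Node M K → ℝ)
    (hbar : Node M K → Node M K → ℝ) (i : Node M K) :
    MemLp (fun ω => G.meanReceived amp hbar t (x ω) i) 2 μ :=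
  memLp_finsetSum _ fun j _ => (hx.memLp_meanState amp hbar j).const_mul _

theorem integral_mul_meanReceived_eq_sum (hx : G.Nonanticipating μ t x)
    (amp : ℕ → Node M K → ℝ) (hφx : MemLp (fun ω => φ (x ω)) 2 μ) (i : Node M K) :
    ∫ ω, φ (x ω) * G.meanReceived amp hbar t (x ω) i ∂μ = ∑ j ∈ G.nbr t i,
      amp t j * hbar i j * ∫ ω, φ (x ω) * G.meanState amp hbar t (x ω) j ∂μ := by
  have hint : ∀ j ∈ G.nbr t i, Integrable
      (fun ω => amp t j * hbar i j * (φ (x ω) * G.meanState amp hbar t (x ω) j)) μ :=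
    fun j _ => (hφx.integrable_mul (hx.memLp_meanState amp hbar j)).const_mul _
  simp only [meanReceived, Finset.mul_sum, mul_left_comm (φ _)]
  rw [integral_finsetSum _ hint]
  simp only [integral_const_mul]

variable [IsProbabilityMeasure μ]

theorem const (y : Fin M → ℝ) : G.Nonanticipating μ t fun _ => y where
  measurable := measurable_const
  memLp k := memLp_const (y k)
  indep := indepFun_const_left y _

section Independence

theorem indepFun_receiverNoise (hx : G.Nonanticipating μ t x) (h4 : G.Assumption4 μ) :
    IndepFun (fun ω => (x ω, fun i j => G.h t i j ω)) (fun ω i j => G.v t i j ω) μ :=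
  have hD := G.measurable_disturbance t
  indepFun_prodMk_left_of_indepFun_prodMk_right hx.measurable hD.snd.snd hD.snd.fst
    (hx.indep.comp measurable_id (measurable_snd.snd.prodMk measurable_snd.fst)) (h4.v_h t).symm

theorem indepFun_column (hx : G.Nonanticipating μ t x) (h3 : G.Assumption3 μ hbar)
    (h4 : G.Assumption4 μ) (j : Node M K) :
    IndepFun (fun ω => (x ω, fun i j => G.v t i j ω,
        fun (k : (Finset.univ.erase j : Finset (Node M K))) i => G.h t i k ω))
      (fun ω i => G.h t i j ω) μ := by
  have hD := G.measurable_disturbance t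
  have hv : Measurable fun ω i j => G.v t i j ω := hD.snd.fst
  have hcol (k : Node M K) : Measurable fun ω i => G.h t i k ω :=
    measurable_pi_lambda _ fun i => G.measurable_h t i k
  have hcols : Measurable fun ω (k : (Finset.univ.erase j : Finset (Node M K))) i =>
      G.h t i k ω := measurable_pi_lambda _ fun k => hcol k
  have hsplit : Measurable fun h : Node M K → Node M K → ℝ =>
      ((fun (k : (Finset.univ.erase j : Finset (Node M K))) i => h i k), fun i => h i j) := by
    fun_prop
  have hnoise := indepFun_prodMk_left_of_indepFun_prodMk_right hv hcols (hcol j)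
    ((h4.v_h t).comp measurable_id hsplit) (h3.indepFun_columns_column t j)
  refine indepFun_prodMk_left_of_indepFun_prodMk_right hx.measurable (hv.prodMk hcols) (hcol j)
    ?_ hnoise
  exact hx.indep.comp measurable_id ((measurable_snd.fst.prodMk
    (hsplit.comp measurable_snd.snd).fst).prodMk (hsplit.comp measurable_snd.snd).snd)

theorem indepFun_nodeState (hx : G.Nonanticipating μ t x) (h3 : G.Assumption3 μ hbar)
    (h4 : G.Assumption4 μ) (amp : ℕ → Node M K → ℝ) (i j : Node M K) :
    IndepFun (fun ω => (x ω, G.nodeState amp t (x ω) ω j)) (G.h t i j) μ := by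
  have hcol := hx.indepFun_column h3 h4 j
  obtain k | j := j
  · exact hcol.comp (φ := fun z => (z.1, z.1 k)) (by fun_prop) (measurable_pi_apply i)
  · let e (k : Fin M) : (Finset.univ.erase (Sum.inr j) : Finset (Node M K)) :=
      ⟨Sum.inl k, by simp⟩
    exact hcol.comp (φ := fun z => (z.1, ∑ k ∈ G.sensorNbr t (Sum.inr j),
      (amp t (Sum.inl k) * z.2.2 (e k) (Sum.inr j) * z.1 k
        + z.2.1 (Sum.inr j) (Sum.inl k)))) (by fun_prop) (measurable_pi_apply i)

end Independence

section SquareIntegrability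

theorem memLp_h_mul_nodeState (hx : G.Nonanticipating μ t x) (h3 : G.Assumption3 μ hbar)
    (h4 : G.Assumption4 μ) {amp : ℕ → Node M K → ℝ} (i : Node M K) {j : Node M K}
    (hj : MemLp (fun ω => G.nodeState amp t (x ω) ω j) 2 μ) :
    MemLp (fun ω => G.h t i j ω * G.nodeState amp t (x ω) ω j) 2 μ :=
  memLp_two_mul_of_indepFun (h3.memLp_h t i j) hj
    ((hx.indepFun_nodeState h3 h4 amp i j).symm.comp measurable_id measurable_snd)

theorem memLp_link (hx : G.Nonanticipating μ t x) (h3 : G.Assumption3 μ hbar)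
    (h4 : G.Assumption4 μ) {amp : ℕ → Node M K → ℝ} (i : Node M K) {j : Node M K}
    (hj : MemLp (fun ω => G.nodeState amp t (x ω) ω j) 2 μ) :
    MemLp (fun ω => amp t j * G.h t i j ω * G.nodeState amp t (x ω) ω j + G.v t i j ω) 2 μ := by
  simp only [mul_assoc]
  exact ((hx.memLp_h_mul_nodeState h3 h4 i hj).const_mul _).add (h3.memLp_v t i j)

theorem memLp_nodeState (hx : G.Nonanticipating μ t x) (h3 : G.Assumption3 μ hbar)
    (h4 : G.Assumption4 μ) (amp : ℕ → Node M K → ℝ) (i : Node M K) :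
    MemLp (fun ω => G.nodeState amp t (x ω) ω i) 2 μ := by
  obtain k | j := i
  · exact hx.memLp k
  · simp only [← received_inr]
    refine memLp_finsetSum _ fun i hi => ?_
    obtain ⟨k, rfl⟩ := exists_inl_of_mem_nbr_inr hi
    exact hx.memLp_link h3 h4 _ (hx.memLp k)

theorem memLp_received (hx : G.Nonanticipating μ t x) (h3 : G.Assumption3 μ hbar)
    (h4 : G.Assumption4 μ) (amp : ℕ → Node M K → ℝ) (i : Node M K) :
    MemLp (fun ω => G.received amp t (x ω) ω i) 2 μ :=
  memLp_finsetSum _ fun j _ => hx.memLp_link h3 h4 i (hx.memLp_nodeState h3 h4 amp j)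

end SquareIntegrability

section MeanReception

theorem integral_mul_link (hx : G.Nonanticipating μ t x) (h3 : G.Assumption3 μ hbar)
    (h4 : G.Assumption4 μ) (amp : ℕ → Node M K → ℝ) (hφ : Measurable φ)
    (hφx : MemLp (fun ω => φ (x ω)) 2 μ) (i j : Node M K) :
    ∫ ω, φ (x ω) * (amp t j * G.h t i j ω * G.nodeState amp t (x ω) ω j + G.v t i j ω) ∂μ
      = amp t j * hbar i j * ∫ ω, φ (x ω) * G.nodeState amp t (x ω) ω j ∂μ := by
  have hstate : Integrable (fun ω => φ (x ω) * G.nodeState amp t (x ω) ω j) μ :=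
    hφx.integrable_mul (hx.memLp_nodeState h3 h4 amp j)
  have hsignal : IndepFun (fun ω => φ (x ω) * G.nodeState amp t (x ω) ω j) (G.h t i j) μ :=
    (hx.indepFun_nodeState h3 h4 amp i j).comp ((hφ.comp measurable_fst).mul measurable_snd)
      measurable_id
  have hnoise : IndepFun (fun ω => φ (x ω)) (G.v t i j) μ :=
    (hx.indepFun_receiverNoise h4).comp (hφ.comp measurable_fst)
      (measurable_pi_apply j |>.comp (measurable_pi_apply i))
  have hint : Integrable (fun ω => φ (x ω) * G.nodeState amp t (x ω) ω j * G.h t i j ω) μ :=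
    hsignal.integrable_mul hstate (h3.integrable_h t i j)
  have hint' : Integrable (fun ω => φ (x ω) * G.v t i j ω) μ :=
    hφx.integrable_mul (h3.memLp_v t i j)
  calc ∫ ω, φ (x ω) * (amp t j * G.h t i j ω * G.nodeState amp t (x ω) ω j + G.v t i j ω) ∂μ
      = ∫ ω, (amp t j * (φ (x ω) * G.nodeState amp t (x ω) ω j * G.h t i j ω)
          + φ (x ω) * G.v t i j ω) ∂μ := by
        congr with ω
        ring
    _ = amp t j * ((∫ ω, φ (x ω) * G.nodeState amp t (x ω) ω j ∂μ) * hbar i j)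
          + (∫ ω, φ (x ω) ∂μ) * 0 := by
        rw [integral_add (hint.const_mul _) hint', integral_const_mul,
          hsignal.integral_fun_mul_eq_mul_integral hstate.aestronglyMeasurable
            (h3.integrable_h t i j).aestronglyMeasurable,
          hnoise.integral_fun_mul_eq_mul_integral hφx.aestronglyMeasurable
            (h3.memLp_v t i j).aestronglyMeasurable, h3.mean_h, h3.mean_v]
    _ = amp t j * hbar i j * ∫ ω, φ (x ω) * G.nodeState amp t (x ω) ω j ∂μ := by ring

theorem integral_mul_received_eq_sum (hx : G.Nonanticipating μ t x) (h3 : G.Assumption3 μ hbar)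
    (h4 : G.Assumption4 μ) (amp : ℕ → Node M K → ℝ) (hφ : Measurable φ)
    (hφx : MemLp (fun ω => φ (x ω)) 2 μ) (i : Node M K) :
    ∫ ω, φ (x ω) * G.received amp t (x ω) ω i ∂μ = ∑ j ∈ G.nbr t i,
      amp t j * hbar i j * ∫ ω, φ (x ω) * G.nodeState amp t (x ω) ω j ∂μ := by
  have hint : ∀ j ∈ G.nbr t i, Integrable (fun ω =>
      φ (x ω) * (amp t j * G.h t i j ω * G.nodeState amp t (x ω) ω j + G.v t i j ω)) μ :=
    fun j _ => hφx.integrable_mul (hx.memLp_link h3 h4 i (hx.memLp_nodeState h3 h4 amp j))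
  simp only [received, Finset.mul_sum]
  rw [integral_finsetSum _ hint]
  simp only [hx.integral_mul_link h3 h4 amp hφ hφx]

theorem integral_mul_nodeState (hx : G.Nonanticipating μ t x) (h3 : G.Assumption3 μ hbar)
    (h4 : G.Assumption4 μ) (amp : ℕ → Node M K → ℝ) (hφ : Measurable φ)
    (hφx : MemLp (fun ω => φ (x ω)) 2 μ) (i : Node M K) :
    ∫ ω, φ (x ω) * G.nodeState amp t (x ω) ω i ∂μ
      = ∫ ω, φ (x ω) * G.meanState amp hbar t (x ω) i ∂μ := by
  obtain k | j := i
  · rfl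
  · simp only [← received_inr, ← meanReceived_inr]
    rw [hx.integral_mul_received_eq_sum h3 h4 amp hφ hφx,
      hx.integral_mul_meanReceived_eq_sum amp hφx]
    refine Finset.sum_congr rfl fun i hi => ?_
    obtain ⟨k, rfl⟩ := exists_inl_of_mem_nbr_inr hi
    rfl

theorem integral_mul_received (hx : G.Nonanticipating μ t x) (h3 : G.Assumption3 μ hbar)
    (h4 : G.Assumption4 μ) (amp : ℕ → Node M K → ℝ) (hφ : Measurable φ)
    (hφx : MemLp (fun ω => φ (x ω)) 2 μ) (i : Node M K) :
    ∫ ω, φ (x ω) * G.received amp t (x ω) ω i ∂μ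
      = ∫ ω, φ (x ω) * G.meanReceived amp hbar t (x ω) i ∂μ := by
  rw [hx.integral_mul_received_eq_sum h3 h4 amp hφ hφx,
    hx.integral_mul_meanReceived_eq_sum amp hφx]
  simp only [hx.integral_mul_nodeState h3 h4 amp hφ hφx]

end MeanReception

end Nonanticipating

section MomentBounds

variable {M K : ℕ} {Ω : Type u} [MeasurableSpace Ω] {G : RelayNetwork M K Ω} {μ : Measure Ω}
  {H V W X : ℝ}

theorem MomentBounds.h_nonneg (hM : G.MomentBounds μ H V W X) (i : Node M K) : 0 ≤ H :=
  (integral_nonneg fun _ => sq_nonneg _).trans (hM.h_le 0 i i)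

theorem MomentBounds.v_nonneg (hM : G.MomentBounds μ H V W X) (i : Node M K) : 0 ≤ V :=
  (integral_nonneg fun _ => sq_nonneg _).trans (hM.v_le 0 i i)

theorem MomentBounds.w_nonneg (hM : G.MomentBounds μ H V W X) (i : Fin M) : 0 ≤ W :=
  (integral_nonneg fun _ => sq_nonneg _).trans (hM.w_le 0 i)

theorem ScalingConstants.sensorPower_le {ds dr Q : ℝ} (hG : G.ScalingConstants ds dr) {t : ℕ}
    {x : Ω → Fin M → ℝ} {k : Fin M} (hQ : ∫ ω, x ω k ^ 2 ∂μ ≤ Q) :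
    scalingRule M K ds dr t (Sum.inl k) ^ 2
        * ∫ ω, G.nodeState (scalingRule M K ds dr) t (x ω) ω (Sum.inl k) ^ 2 ∂μ
      ≤ Q / ds := by
  rw [scalingRule, rpow_neg_half_sq hG.ds_pos.le, div_eq_inv_mul]
  exact mul_le_mul_of_nonneg_left hQ (inv_nonneg.2 hG.ds_pos.le)

end MomentBounds

/-- The factor by which a node with at most `n` neighbours amplifies the second moments of the
sensor estimates, when these are bounded by some `Q ≥ 1` and the fading coefficients and receiver
noises have second moments at most `H` and `V`. -/
def receptionBound (n H V : ℝ) : ℝ :=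
  2 * n * (H * (1 + (H + V)) + n * V)

namespace Nonanticipating

section SecondMoments

variable {M K : ℕ} {Ω : Type u} [MeasurableSpace Ω] {G : RelayNetwork M K Ω} {μ : Measure Ω}
  [IsProbabilityMeasure μ] {hbar : Node M K → Node M K → ℝ} {t : ℕ} {x : Ω → Fin M → ℝ}
  {ds dr H V W X Q : ℝ}

theorem integral_h_mul_nodeState_sq_le (hx : G.Nonanticipating μ t x)
    (h3 : G.Assumption3 μ hbar) (h4 : G.Assumption4 μ) (hM : G.MomentBounds μ H V W X)
    (amp : ℕ → Node M K → ℝ) (i j : Node M K) :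
    ∫ ω, (G.h t i j ω * G.nodeState amp t (x ω) ω j) ^ 2 ∂μ
      ≤ H * ∫ ω, G.nodeState amp t (x ω) ω j ^ 2 ∂μ := by
  rw [integral_mul_sq_of_indepFun (h3.memLp_h t i j) (hx.memLp_nodeState h3 h4 amp j)
    ((hx.indepFun_nodeState h3 h4 amp i j).symm.comp measurable_id measurable_snd)]
  exact mul_le_mul_of_nonneg_right (hM.h_le t i j) (integral_nonneg fun _ => sq_nonneg _)

theorem integral_link_sq_le (hx : G.Nonanticipating μ t x)
    (h3 : G.Assumption3 μ hbar) (h4 : G.Assumption4 μ) (hM : G.MomentBounds μ H V W X)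
    (amp : ℕ → Node M K → ℝ) (i j : Node M K) :
    ∫ ω, (amp t j * G.h t i j ω * G.nodeState amp t (x ω) ω j + G.v t i j ω) ^ 2 ∂μ
      ≤ 2 * (H * (amp t j ^ 2 * ∫ ω, G.nodeState amp t (x ω) ω j ^ 2 ∂μ) + V) := by
  have hfaded := hx.memLp_h_mul_nodeState h3 h4 i (hx.memLp_nodeState h3 h4 amp j)
  have hsignal := hx.integral_h_mul_nodeState_sq_le h3 h4 hM amp i j
  simp only [mul_assoc (amp t j)]
  refine (integral_add_sq_le (hfaded.const_mul _) (h3.memLp_v t i j)).trans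
    (mul_le_mul_of_nonneg_left (add_le_add ?_ (hM.v_le t i j)) zero_le_two)
  simp only [mul_pow (amp t j), integral_const_mul]
  rw [mul_left_comm]
  exact mul_le_mul_of_nonneg_left hsignal (sq_nonneg _)

/-- Unlike in `integral_link_sq_le`, nothing is lost to the cross term: a receiver noise may be
correlated with the signal of a relay, but not with that of a sensor. -/
theorem integral_sensorLink_sq_le (hx : G.Nonanticipating μ t x)
    (h3 : G.Assumption3 μ hbar) (h4 : G.Assumption4 μ) (hM : G.MomentBounds μ H V W X)
    (c : ℝ) (i : Node M K) (k : Fin M) (hQ : ∫ ω, x ω k ^ 2 ∂μ ≤ Q) :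
    ∫ ω, (c * G.h t i (Sum.inl k) ω * x ω k + G.v t i (Sum.inl k) ω) ^ 2 ∂μ
      ≤ c ^ 2 * (H * Q) + V := by
  have hfaded : MemLp (fun ω => G.h t i (Sum.inl k) ω * x ω k) 2 μ :=
    hx.memLp_h_mul_nodeState (amp := 0) h3 h4 i (j := Sum.inl k) (hx.memLp k)
  have hsignal : ∫ ω, (G.h t i (Sum.inl k) ω * x ω k) ^ 2 ∂μ ≤ H * ∫ ω, x ω k ^ 2 ∂μ :=
    hx.integral_h_mul_nodeState_sq_le h3 h4 hM 0 i (Sum.inl k)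
  have hnoise : IndepFun (fun ω => c * (G.h t i (Sum.inl k) ω * x ω k))
      (G.v t i (Sum.inl k)) μ :=
    (hx.indepFun_receiverNoise h4).comp
      (φ := fun z : (Fin M → ℝ) × (Node M K → Node M K → ℝ) => c * (z.2 i (Sum.inl k) * z.1 k))
      (ψ := fun v : Node M K → Node M K → ℝ => v i (Sum.inl k)) (by fun_prop) (by fun_prop)
  simp only [mul_assoc c]
  rw [integral_add_sq_of_indepFun (hfaded.const_mul c) (h3.memLp_v ..) hnoise (h3.mean_v ..)]
  simp only [mul_pow c, integral_const_mul]
  gcongr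
  · exact hsignal.trans (mul_le_mul_of_nonneg_left hQ (hM.h_nonneg i))
  · exact hM.v_le ..

variable (hx : G.Nonanticipating μ t x) (hG : G.ScalingConstants ds dr)
  (h3 : G.Assumption3 μ hbar) (h4 : G.Assumption4 μ) (hM : G.MomentBounds μ H V W X)
  (hQ : ∀ k, ∫ ω, x ω k ^ 2 ∂μ ≤ Q)
include hx hG h3 h4 hM hQ

theorem integral_nodeState_inr_sq_le (j : Fin K) :
    ∫ ω, G.nodeState (scalingRule M K ds dr) t (x ω) ω (Sum.inr j) ^ 2 ∂μ
      ≤ ((G.sensorNbr t (Sum.inr j)).card : ℝ) ^ 2 * (H * Q + V) := by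
  have hlink : ∀ k ∈ G.sensorNbr t (Sum.inr j),
      ∫ ω, (ds ^ (-(1 / 2) : ℝ) * G.h t (Sum.inr j) (Sum.inl k) ω * x ω k
        + G.v t (Sum.inr j) (Sum.inl k) ω) ^ 2 ∂μ ≤ H * Q + V := fun k hk => by
    have hQ0 : 0 ≤ Q := (integral_nonneg fun _ => sq_nonneg _).trans (hQ k)
    refine (hx.integral_sensorLink_sq_le h3 h4 hM _ (Sum.inr j) k (hQ k)).trans
      (add_le_add_left (mul_le_of_le_one_left (mul_nonneg (hM.h_nonneg (Sum.inl k)) hQ0) ?_) V)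
    rw [rpow_neg_half_sq hG.ds_pos.le]
    exact inv_le_one_of_one_le₀ (hG.one_le_ds ⟨k, hk⟩)
  calc ∫ ω, G.nodeState (scalingRule M K ds dr) t (x ω) ω (Sum.inr j) ^ 2 ∂μ
      ≤ (G.sensorNbr t (Sum.inr j)).card * ∑ k ∈ G.sensorNbr t (Sum.inr j),
          ∫ ω, (ds ^ (-(1 / 2) : ℝ) * G.h t (Sum.inr j) (Sum.inl k) ω * x ω k
            + G.v t (Sum.inr j) (Sum.inl k) ω) ^ 2 ∂μ :=
        integral_sum_sq_le_card_mul_sum (G.sensorNbr t (Sum.inr j)) fun k _ =>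
          hx.memLp_link (amp := scalingRule M K ds dr) h3 h4 (Sum.inr j) (j := Sum.inl k)
            (hx.memLp k)
    _ ≤ (G.sensorNbr t (Sum.inr j)).card * ((G.sensorNbr t (Sum.inr j)).card * (H * Q + V)) := by
        rw [← nsmul_eq_mul (G.sensorNbr t (Sum.inr j)).card (H * Q + V)]
        exact mul_le_mul_of_nonneg_left (Finset.sum_le_card_nsmul _ _ _ hlink) (Nat.cast_nonneg _)
    _ = ((G.sensorNbr t (Sum.inr j)).card : ℝ) ^ 2 * (H * Q + V) := by ring

theorem relayPower_le (j : Fin K) :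
    scalingRule M K ds dr t (Sum.inr j) ^ 2
        * ∫ ω, G.nodeState (scalingRule M K ds dr) t (x ω) ω (Sum.inr j) ^ 2 ∂μ
      ≤ ((G.sensorNbr t (Sum.inr j)).card : ℝ) ^ 2 / dr * (H * Q + V) := by
  rw [scalingRule, rpow_neg_half_sq hG.dr_pos.le, div_eq_inv_mul, mul_assoc]
  exact mul_le_mul_of_nonneg_left (hx.integral_nodeState_inr_sq_le hG h3 h4 hM hQ j)
    (inv_nonneg.2 hG.dr_pos.le)

theorem sum_power_le (hQ0 : 0 ≤ Q) (i : Node M K) :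
    ∑ j ∈ G.nbr t i, scalingRule M K ds dr t j ^ 2
        * ∫ ω, G.nodeState (scalingRule M K ds dr) t (x ω) ω j ^ 2 ∂μ
      ≤ Q + (H * Q + V) := by
  have hds := hG.ds_pos
  have hdr := hG.dr_pos
  have hH := hM.h_nonneg i
  have hV := hM.v_nonneg i
  rw [sum_nbr]
  refine add_le_add ?_ ?_
  · calc _ ≤ ∑ _k ∈ G.sensorNbr t i, Q / ds :=
          Finset.sum_le_sum fun k _ => hG.sensorPower_le (hQ k)
      _ = (G.sensorNbr t i).card * (Q / ds) := by rw [Finset.sum_const, nsmul_eq_mul]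
      _ ≤ ds * (Q / ds) := mul_le_mul_of_nonneg_right (hG.le_ds t i) (by positivity)
      _ = Q := mul_div_cancel₀ Q hds.ne'
  · calc _ ≤ ∑ j ∈ G.relayNbr t i,
            ((G.sensorNbr t (Sum.inr j)).card : ℝ) ^ 2 / dr * (H * Q + V) :=
          Finset.sum_le_sum fun j _ => hx.relayPower_le hG h3 h4 hM hQ j
      _ = (∑ j ∈ G.relayNbr t i, ((G.sensorNbr t (Sum.inr j)).card : ℝ) ^ 2) / dr
            * (H * Q + V) := by rw [← Finset.sum_mul, Finset.sum_div]
      _ ≤ H * Q + V := mul_le_of_le_one_left (by positivity)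
          ((div_le_one hdr).2 (hG.sum_card_sensorNbr_sq_le t i))

theorem integral_received_sq_le (hQ1 : 1 ≤ Q) {n : ℝ} {i : Node M K}
    (hn : ((G.nbr t i).card : ℝ) ≤ n) :
    ∫ ω, G.received (scalingRule M K ds dr) t (x ω) ω i ^ 2 ∂μ ≤ receptionBound n H V * Q := by
  have hH := hM.h_nonneg i
  have hV := hM.v_nonneg i
  have hn0 : 0 ≤ n := (Nat.cast_nonneg _).trans hn
  have hVQ : V ≤ V * Q := le_mul_of_one_le_right hV hQ1
  have hpower := (hx.sum_power_le hG h3 h4 hM hQ (zero_le_one.trans hQ1) i).trans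
    (by gcongr : Q + (H * Q + V) ≤ Q + (H * Q + V * Q))
  have hnoise : (G.nbr t i).card * V ≤ n * (V * Q) := mul_le_mul hn hVQ hV hn0
  calc ∫ ω, G.received (scalingRule M K ds dr) t (x ω) ω i ^ 2 ∂μ
      ≤ (G.nbr t i).card * ∑ j ∈ G.nbr t i, 2 * (H * (scalingRule M K ds dr t j ^ 2
          * ∫ ω, G.nodeState (scalingRule M K ds dr) t (x ω) ω j ^ 2 ∂μ) + V) :=
        (integral_sum_sq_le_card_mul_sum _ fun j _ =>
          hx.memLp_link h3 h4 i (hx.memLp_nodeState h3 h4 _ j)).trans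
          (mul_le_mul_of_nonneg_left (Finset.sum_le_sum fun j _ =>
            hx.integral_link_sq_le h3 h4 hM _ i j) (Nat.cast_nonneg _))
    _ = (G.nbr t i).card * (2 * (H * (∑ j ∈ G.nbr t i, scalingRule M K ds dr t j ^ 2
          * ∫ ω, G.nodeState (scalingRule M K ds dr) t (x ω) ω j ^ 2 ∂μ)
          + (G.nbr t i).card * V)) := by
        rw [← Finset.mul_sum, Finset.sum_add_distrib, ← Finset.mul_sum, Finset.sum_const,
          nsmul_eq_mul]
    _ ≤ n * (2 * (H * (Q + (H * Q + V * Q)) + n * (V * Q))) := by gcongr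
    _ = receptionBound n H V * Q := by
        rw [receptionBound]
        ring

end SecondMoments

end Nonanticipating

section Weight

variable {M K : ℕ} {Ω : Type u} [MeasurableSpace Ω] {G : RelayNetwork M K Ω} {μ : Measure Ω}
  [IsProbabilityMeasure μ] {hbar : Node M K → Node M K → ℝ} {t : ℕ} {ds dr H V W X : ℝ}

theorem weight_sq_le (hG : G.ScalingConstants ds dr) (h3 : G.Assumption3 μ hbar)
    (h4 : G.Assumption4 μ) (hM : G.MomentBounds μ H V W X) {n : ℝ} {i : Fin M}
    (hn : ((G.nbr t (Sum.inl i)).card : ℝ) ≤ n) :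
    G.weight ds dr hbar t i ^ 2 ≤ receptionBound n H V := by
  have hone : G.Nonanticipating μ t fun _ => 1 := .const 1
  have hmean : ∫ ω, G.received (scalingRule M K ds dr) t 1 ω (Sum.inl i) ∂μ
      = G.weight ds dr hbar t i := by
    simpa only [one_mul, integral_const, probReal_univ, one_smul,
      ← weight_eq_meanReceived_one hG.ds_pos.le hG.dr_pos.le] using
      hone.integral_mul_received h3 h4 (scalingRule M K ds dr) (φ := fun _ => 1)
        measurable_const (memLp_const 1) (Sum.inl i)
  rw [← hmean, ← mul_one (receptionBound n H V)]
  exact (sq_integral_le_integral_sq (hone.memLp_received h3 h4 _ _)).trans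
    (hone.integral_received_sq_le hG h3 h4 hM (by simp) le_rfl hn)

end Weight

/-- The rate of growth of the second moments in one step of the algorithm: a step with step size `a`
multiplies them by at most `1 + stepGrowth ρ W * a ^ 2`, when the measurement noises have second
moments at most `W`, and the received data have second moments at most `ρ` times those of the
sensor estimates. -/
def stepGrowth (ρ W : ℝ) : ℝ :=
  8 * (1 + ρ) + 2 * (W + ρ)

namespace Nonanticipating

section Step

variable {M K : ℕ} {Ω : Type u} [MeasurableSpace Ω] {G : RelayNetwork M K Ω} {μ : Measure Ω}
  {amp : ℕ → Node M K → ℝ} {hbar : Node M K → Node M K → ℝ} {t : ℕ} {x : Ω → Fin M → ℝ} {r : ℝ}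

theorem lpNorm_meanState_le (hx : G.Nonanticipating μ t x) (hamp : ∀ j, 0 ≤ amp t j)
    (hbar_nonneg : ∀ i j, 0 ≤ hbar i j) (hr : ∀ k, lpNorm (fun ω => x ω k) 2 μ ≤ r)
    (i : Node M K) :
    lpNorm (fun ω => G.meanState amp hbar t (x ω) i) 2 μ ≤ G.meanState amp hbar t 1 i * r := by
  obtain k | j := i
  · simpa only [meanState, Sum.elim_inl, Pi.one_apply, one_mul] using hr k
  · simp only [meanState, Sum.elim_inr, Pi.one_apply, mul_one, Finset.sum_mul]
    exact lpNorm_sum_const_mul_le _ (fun k _ => mul_nonneg (hamp _) (hbar_nonneg _ _))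
      one_le_two (fun k _ => hx.memLp k) fun k _ => hr k

theorem lpNorm_meanReceived_le (hx : G.Nonanticipating μ t x) (hamp : ∀ j, 0 ≤ amp t j)
    (hbar_nonneg : ∀ i j, 0 ≤ hbar i j) (hr : ∀ k, lpNorm (fun ω => x ω k) 2 μ ≤ r)
    (i : Node M K) :
    lpNorm (fun ω => G.meanReceived amp hbar t (x ω) i) 2 μ
      ≤ G.meanReceived amp hbar t 1 i * r := by
  refine (lpNorm_sum_const_mul_le _ (fun j _ => mul_nonneg (hamp j) (hbar_nonneg i j))
    one_le_two (fun j _ => hx.memLp_meanState amp hbar j)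
    fun j _ => hx.lpNorm_meanState_le hamp hbar_nonneg hr j).trans_eq ?_
  simp only [meanReceived, Finset.sum_mul, mul_assoc]

variable [IsProbabilityMeasure μ]

-- For `s ≤ 1` the mean step is a convex combination of `θ` and the entries of `x`, so `L²` norms do
-- not grow; the absolute value accounts for the steps with `s > 1`.
theorem lpNorm_meanStep_le (hx : G.Nonanticipating μ t x) (hamp : ∀ j, 0 ≤ amp t j)
    (hbar_nonneg : ∀ i j, 0 ≤ hbar i j) (hr : ∀ k, lpNorm (fun ω => x ω k) 2 μ ≤ r)
    {a χ θ s : ℝ} (ha : 0 ≤ a) (hχ : 0 ≤ χ) (hθ : |θ| ≤ r) {i : Fin M}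
    (hs : s = a * (χ + G.meanReceived amp hbar t 1 (Sum.inl i))) :
    lpNorm (fun ω => (1 - s) * x ω i + a * χ * θ
        + a * G.meanReceived amp hbar t (x ω) (Sum.inl i)) 2 μ ≤ (|1 - s| + s) * r := by
  have hkept := (hx.memLp i).const_mul (1 - s)
  have hconst : MemLp (fun _ => a * χ * θ) 2 μ := memLp_const _
  have hlpNorm_const : lpNorm (fun _ => a * χ * θ) 2 μ = a * χ * |θ| := by
    rw [lpNorm_const' two_ne_zero ENNReal.ofNat_ne_top, probReal_univ, Real.one_rpow, mul_one,
      Real.norm_eq_abs, abs_mul, abs_of_nonneg (mul_nonneg ha hχ)]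
  calc _ ≤ lpNorm (fun ω => (1 - s) * x ω i) 2 μ + lpNorm (fun _ => a * χ * θ) 2 μ
          + lpNorm (fun ω => a * G.meanReceived amp hbar t (x ω) (Sum.inl i)) 2 μ :=
        (lpNorm_add_le (hkept.add hconst) one_le_two).trans
          (add_le_add_left (lpNorm_add_le hkept one_le_two) _)
    _ = |1 - s| * lpNorm (fun ω => x ω i) 2 μ + a * χ * |θ|
          + a * lpNorm (fun ω => G.meanReceived amp hbar t (x ω) (Sum.inl i)) 2 μ := by
        rw [hlpNorm_const, lpNorm_const_mul, lpNorm_const_mul, abs_of_nonneg ha]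
    _ ≤ |1 - s| * r + a * χ * r + a * (G.meanReceived amp hbar t 1 (Sum.inl i) * r) := by
        gcongr
        · exact hr i
        · exact hx.lpNorm_meanReceived_le hamp hbar_nonneg hr _
    _ = (|1 - s| + s) * r := by
        rw [hs]
        ring

theorem memLp_innovation (hx : G.Nonanticipating μ t x) (h3 : G.Assumption3 μ hbar)
    (h4 : G.Assumption4 μ) (hw : ∀ i, MemLp (G.w t i) 2 μ) (amp : ℕ → Node M K → ℝ) (χ : ℝ)
    (i : Fin M) :
    MemLp (fun ω => χ * G.w t i ω + G.received amp t (x ω) ω (Sum.inl i)) 2 μ :=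
  ((hw i).const_mul χ).add (hx.memLp_received h3 h4 amp _)

theorem integral_mul_innovation (hx : G.Nonanticipating μ t x) (h3 : G.Assumption3 μ hbar)
    (h4 : G.Assumption4 μ) (hw : ∀ i, MemLp (G.w t i) 2 μ) (hw0 : ∀ i, ∫ ω, G.w t i ω ∂μ = 0)
    (amp : ℕ → Node M K → ℝ) (χ : ℝ) {φ : (Fin M → ℝ) → ℝ} (hφ : Measurable φ)
    (hφx : MemLp (fun ω => φ (x ω)) 2 μ) (i : Fin M) :
    ∫ ω, φ (x ω) * (χ * G.w t i ω + G.received amp t (x ω) ω (Sum.inl i)) ∂μ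
      = ∫ ω, φ (x ω) * G.meanReceived amp hbar t (x ω) (Sum.inl i) ∂μ := by
  have hindep : IndepFun (fun ω => φ (x ω)) (fun ω => χ * G.w t i ω) μ :=
    hx.indep.comp (ψ := fun d : (Fin M → ℝ) × (Node M K → Node M K → ℝ) ×
      (Node M K → Node M K → ℝ) => χ * d.1 i) hφ (by fun_prop)
  have hwχ := (hw i).const_mul χ
  have hnoise : Integrable (fun ω => φ (x ω) * (χ * G.w t i ω)) μ := hφx.integrable_mul hwχ
  have hreceived : Integrable (fun ω => φ (x ω) * G.received amp t (x ω) ω (Sum.inl i)) μ :=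
    hφx.integrable_mul (hx.memLp_received h3 h4 amp _)
  simp only [mul_add]
  rw [integral_add hnoise hreceived, hx.integral_mul_received h3 h4 amp hφ hφx,
    hindep.integral_fun_mul_eq_mul_integral hφx.aestronglyMeasurable hwχ.aestronglyMeasurable,
    integral_const_mul, hw0]
  ring

variable {ds dr H V W X n a χ θ Z : ℝ} {i : Fin M}

theorem integral_innovation_sq_le (hx : G.Nonanticipating μ t x) (hG : G.ScalingConstants ds dr)
    (h3 : G.Assumption3 μ hbar) (h4 : G.Assumption4 μ) (hw : ∀ i, MemLp (G.w t i) 2 μ)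
    (hM : G.MomentBounds μ H V W X) (hn : ((G.nbr t (Sum.inl i)).card : ℝ) ≤ n)
    (hχ0 : 0 ≤ χ) (hχ1 : χ ≤ 1) (hZ : 1 ≤ Z) (hxZ : ∀ k, ∫ ω, x ω k ^ 2 ∂μ ≤ Z) :
    ∫ ω, (χ * G.w t i ω + G.received (scalingRule M K ds dr) t (x ω) ω (Sum.inl i)) ^ 2 ∂μ
      ≤ 2 * (W + receptionBound n H V) * Z := by
  have hnoise : ∫ ω, (χ * G.w t i ω) ^ 2 ∂μ ≤ W * Z := by
    simp only [mul_pow, integral_const_mul]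
    exact (mul_le_of_le_one_left (integral_nonneg fun _ => sq_nonneg _)
      (pow_le_one₀ hχ0 hχ1)).trans
      ((hM.w_le t i).trans (le_mul_of_one_le_right (hM.w_nonneg i) hZ))
  have hreceived := hx.integral_received_sq_le hG h3 h4 hM hxZ hZ hn
  calc _ ≤ 2 * (∫ ω, (χ * G.w t i ω) ^ 2 ∂μ
          + ∫ ω, G.received (scalingRule M K ds dr) t (x ω) ω (Sum.inl i) ^ 2 ∂μ) :=
        integral_add_sq_le ((hw i).const_mul χ) (hx.memLp_received h3 h4 _ _)
    _ ≤ 2 * (W * Z + receptionBound n H V * Z) := by gcongr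
    _ = 2 * (W + receptionBound n H V) * Z := by ring

theorem integral_meanStep_sq_le (hx : G.Nonanticipating μ t x) (hG : G.ScalingConstants ds dr)
    (h3 : G.Assumption3 μ hbar) (ha : 0 ≤ a) (hχ : 0 ≤ χ) (hZ : 0 ≤ Z) (hθ : θ ^ 2 ≤ Z)
    (hxZ : ∀ k, ∫ ω, x ω k ^ 2 ∂μ ≤ Z) {s : ℝ} (hs : s = a * (χ + G.weight ds dr hbar t i)) :
    ∫ ω, ((1 - s) * x ω i + a * χ * θ
        + a * G.meanReceived (scalingRule M K ds dr) hbar t (x ω) (Sum.inl i)) ^ 2 ∂μ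
      ≤ (1 + 4 * s ^ 2) * Z := by
  have hamp := scalingRule_nonneg (M := M) (K := K) hG.ds_pos.le hG.dr_pos.le t
  have hbar_nonneg (i j : Node M K) : 0 ≤ hbar i j := (h3.hbar_pos i j).le
  rw [weight_eq_meanReceived_one hG.ds_pos.le hG.dr_pos.le] at hs
  have hs0 : 0 ≤ s := hs ▸ mul_nonneg ha
    (add_nonneg hχ (meanReceived_nonneg hamp hbar_nonneg (fun _ => zero_le_one) _))
  have hlpNorm_x (k : Fin M) : lpNorm (fun ω => x ω k) 2 μ ≤ √Z :=
    (lpNorm_two_le_iff (hx.memLp k).aestronglyMeasurable (Real.sqrt_nonneg Z)).2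
      ((hxZ k).trans_eq (Real.sq_sqrt hZ).symm)
  have hstep : MemLp (fun ω => (1 - s) * x ω i + a * χ * θ
      + a * G.meanReceived (scalingRule M K ds dr) hbar t (x ω) (Sum.inl i)) 2 μ :=
    (((hx.memLp i).const_mul _).add (memLp_const _)).add
      ((hx.memLp_meanReceived _ hbar _).const_mul a)
  calc _ ≤ ((|1 - s| + s) * √Z) ^ 2 :=
        (lpNorm_two_le_iff hstep.aestronglyMeasurable (by positivity)).1
          (hx.lpNorm_meanStep_le hamp hbar_nonneg hlpNorm_x ha hχ (Real.abs_le_sqrt hθ) hs)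
    _ = (|1 - s| + s) ^ 2 * Z := by rw [mul_pow, Real.sq_sqrt hZ]
    _ ≤ (1 + 4 * s ^ 2) * Z := mul_le_mul_of_nonneg_right (sq_abs_one_sub_add_le s) hZ

theorem integral_step_sq_le (hx : G.Nonanticipating μ t x) (hG : G.ScalingConstants ds dr)
    (h3 : G.Assumption3 μ hbar) (h4 : G.Assumption4 μ) (hw : ∀ i, MemLp (G.w t i) 2 μ)
    (hw0 : ∀ i, ∫ ω, G.w t i ω ∂μ = 0) (hM : G.MomentBounds μ H V W X)
    (hn : ((G.nbr t (Sum.inl i)).card : ℝ) ≤ n) (ha : 0 ≤ a) (hχ0 : 0 ≤ χ) (hχ1 : χ ≤ 1)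
    (hZ : 1 ≤ Z) (hθ : θ ^ 2 ≤ Z) (hxZ : ∀ k, ∫ ω, x ω k ^ 2 ∂μ ≤ Z) :
    ∫ ω, ((1 - a * (χ + G.weight ds dr hbar t i)) * x ω i + a * χ * θ + a * (χ * G.w t i ω
        + G.received (scalingRule M K ds dr) t (x ω) ω (Sum.inl i))) ^ 2 ∂μ
      ≤ (1 + stepGrowth (receptionBound n H V) W * a ^ 2) * Z := by
  set b := G.weight ds dr hbar t i
  set ρ := receptionBound n H V
  have hZ0 : 0 ≤ Z := zero_le_one.trans hZ
  have hgain : (χ + b) ^ 2 ≤ 2 * (1 + ρ) :=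
    add_sq_le.trans (by gcongr; exacts [pow_le_one₀ hχ0 hχ1, weight_sq_le hG h3 h4 hM hn])
  have hkept : MemLp (fun ω => (1 - a * (χ + b)) * x ω i + a * χ * θ) 2 μ :=
    ((hx.memLp i).const_mul _).add (memLp_const _)
  have hmean := hx.integral_mul_innovation h3 h4 hw hw0 (scalingRule M K ds dr) χ
    (φ := fun x => (1 - a * (χ + b)) * x i + a * χ * θ) (by fun_prop) hkept i
  calc _ ≤ (1 + 4 * (a * (χ + b)) ^ 2) * Z + a ^ 2 * (2 * (W + ρ) * Z) :=
        (integral_add_mul_sq_le hkept (hx.memLp_innovation h3 h4 hw _ χ i)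
          (hx.memLp_meanReceived _ hbar _) hmean a).trans (add_le_add
            (hx.integral_meanStep_sq_le hG h3 ha hχ0 hZ0 hθ hxZ rfl)
            (mul_le_mul_of_nonneg_left
              (hx.integral_innovation_sq_le hG h3 h4 hw hM hn hχ0 hχ1 hZ hxZ) (sq_nonneg a)))
    _ ≤ (1 + 4 * (a ^ 2 * (2 * (1 + ρ)))) * Z + a ^ 2 * (2 * (W + ρ) * Z) := by
        rw [mul_pow]
        gcongr
    _ = (1 + stepGrowth ρ W * a ^ 2) * Z := by
        rw [stepGrowth]
        ring

end Step

end Nonanticipating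

/-- The indicator `χ_i(t)` of the event that sensor `i` has a measurement at time `t`. -/
def measuringIndicator {M K : ℕ} {Ω : Type u} [MeasurableSpace Ω] (G : RelayNetwork M K Ω) (t : ℕ)
    (i : Fin M) : ℝ :=
  if i ∈ G.measuring t then 1 else 0

/-- The bound on the second moments of the sensor estimates after steps of square sum `A`. The
number `ds + dr + q` bounds the number of neighbours of a node. -/
noncomputable def secondMomentBound (θ ds dr H V W X : ℝ) (q : ℕ) (A : ℝ) : ℝ :=
  (X + θ ^ 2 + 1) * Real.exp (stepGrowth (receptionBound (ds + dr + q) H V) W * A)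

section SecondMomentBound

variable {M K : ℕ} {Ω : Type u} [MeasurableSpace Ω] {G : RelayNetwork M K Ω} {μ : Measure Ω}
  {θ ds dr H V W X : ℝ}

theorem secondMomentBound_mono {n : ℕ} {A A' : ℝ} (hG : G.ScalingConstants ds dr)
    (hM : G.MomentBounds μ H V W X) (i : Fin M) (hA : A ≤ A') :
    secondMomentBound θ ds dr H V W X n A ≤ secondMomentBound θ ds dr H V W X n A' := by
  have hds := hG.ds_pos
  have hdr := hG.dr_pos
  have hH := hM.h_nonneg (Sum.inl i)
  have hV := hM.v_nonneg (Sum.inl i)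
  have hW := hM.w_nonneg i
  have hX : 0 ≤ X := (integral_nonneg fun _ => sq_nonneg _).trans (hM.x₀_le i)
  unfold secondMomentBound stepGrowth receptionBound
  gcongr

end SecondMomentBound

section SensorEstimate

variable {M K : ℕ} {Ω : Type u} [MeasurableSpace Ω] {G : RelayNetwork M K Ω} {μ : Measure Ω}
  [IsProbabilityMeasure μ] {hbar : Node M K → Node M K → ℝ} {ds dr H V W X : ℝ} {q : ℕ}
  (θ : ℝ) (a : ℕ → ℝ) (amp : ℕ → Node M K → ℝ) (b : ℕ → Fin M → ℝ) (t : ℕ)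

theorem sensorEstimate_succ (ω : Ω) (i : Fin M) :
    G.sensorEstimate θ a amp b (t + 1) ω i
      = (1 - a t * (G.measuringIndicator t i + b t i)) * G.sensorEstimate θ a amp b t ω i
        + a t * G.measuringIndicator t i * θ
        + a t * (G.measuringIndicator t i * G.w t i ω
          + G.received amp t (G.sensorEstimate θ a amp b t ω) ω (Sum.inl i)) := by
  rw [sensorEstimate, measuringIndicator]
  split_ifs <;> ring

theorem indepFun_sensorEstimate_disturbance (h4 : G.Assumption4 μ) (h0 : G.AdmissibleInit μ) :
    IndepFun (G.sensorEstimate θ a amp b t) (G.disturbance t) μ := by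
  let past (ω : Ω) := ((fun i => G.x₀ i ω), fun s : Finset.range t => G.disturbance s ω)
  have hpast : IndepFun past (G.disturbance t) μ := by
    refine indepFun_prodMk_left_of_indepFun_prodMk_right
      (measurable_pi_lambda _ G.measurable_x₀)
      (measurable_pi_lambda _ fun s => G.measurable_disturbance s) (G.measurable_disturbance t)
      (h0.indep.comp (φ := id) (ψ := fun d : ℕ → (Fin M → ℝ) × (Node M K → Node M K → ℝ) ×
        (Node M K → Node M K → ℝ) => ((fun s : Finset.range t => d s), d t)) measurable_id
        (by fun_prop)) ?_
    exact (h4.over_time.indepFun_finset (Finset.range t) {t} (by simp)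
      G.measurable_disturbance).comp measurable_id
      (measurable_pi_apply (⟨t, Finset.mem_singleton_self t⟩ : ({t} : Finset ℕ)))
  have hmeasurable : Measurable[MeasurableSpace.comap past inferInstance]
      (G.sensorEstimate θ a amp b t) := by
    have hpast' : Measurable[MeasurableSpace.comap past inferInstance] past :=
      comap_measurable past
    exact measurable_sensorEstimate (mβ := MeasurableSpace.comap past inferInstance) (ι := id)
      θ a amp b hpast'.fst fun s hs =>
        (measurable_pi_apply (⟨s, Finset.mem_range.2 hs⟩ : Finset.range t)).comp hpast'.snd
  exact indep_of_indep_of_le_left hpast hmeasurable.comap_le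

theorem nonanticipating_sensorEstimate (h3 : G.Assumption3 μ hbar) (h4 : G.Assumption4 μ)
    (h0 : G.AdmissibleInit μ) (hw : ∀ t i, MemLp (G.w t i) 2 μ) :
    G.Nonanticipating μ t (G.sensorEstimate θ a amp b t) := by
  have of_memLp (t : ℕ) (hmemLp : ∀ i, MemLp (fun ω => G.sensorEstimate θ a amp b t ω i) 2 μ) :
      G.Nonanticipating μ t (G.sensorEstimate θ a amp b t) := {
    measurable := measurable_sensorEstimate (ι := id) θ a amp b
      (measurable_pi_lambda _ G.measurable_x₀) fun s _ => G.measurable_disturbance s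
    memLp := hmemLp
    indep := indepFun_sensorEstimate_disturbance θ a amp b t h4 h0 }
  refine of_memLp t ?_
  induction t with
  | zero => exact h0.memLp
  | succ t ih =>
    have hx := of_memLp t ih
    intro i
    simp only [sensorEstimate_succ]
    exact (((hx.memLp i).const_mul _).add (memLp_const _)).add
      ((hx.memLp_innovation h3 h4 (hw t) amp _ i).const_mul _)

theorem integral_sensorEstimate_sq_le (hG : G.ScalingConstants ds dr)
    (hq : G.IdleRelayBound q) (h3 : G.Assumption3 μ hbar) (h4 : G.Assumption4 μ)
    (h0 : G.AdmissibleInit μ) (hw : ∀ t i, MemLp (G.w t i) 2 μ)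
    (hw0 : ∀ t i, ∫ ω, G.w t i ω ∂μ = 0) (hM : G.MomentBounds μ H V W X) (ha : ∀ t, 0 ≤ a t)
    (i : Fin M) :
    ∫ ω, G.sensorEstimate θ a (scalingRule M K ds dr) (G.weight ds dr hbar) t ω i ^ 2 ∂μ
      ≤ secondMomentBound θ ds dr H V W X q (∑ s ∈ Finset.range t, a s ^ 2) := by
  set c := stepGrowth (receptionBound (ds + dr + q) H V) W with hc
  have hcard (t : ℕ) (i : Node M K) := hG.card_nbr_le hq t i
  have hX : 0 ≤ X := (integral_nonneg fun _ => sq_nonneg _).trans (hM.x₀_le i)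
  have hρ : 0 ≤ receptionBound (ds + dr + q) H V :=
    (sq_nonneg _).trans (weight_sq_le hG h3 h4 hM (hcard 0 (Sum.inl i)))
  have hc0 : 0 ≤ c := by
    rw [hc, stepGrowth]
    linarith [hM.w_nonneg i]
  induction t generalizing i with
  | zero =>
    rw [secondMomentBound, Finset.sum_range_zero, mul_zero, Real.exp_zero, mul_one]
    have hx₀ : ∫ ω, G.sensorEstimate θ a (scalingRule M K ds dr) (G.weight ds dr hbar) 0 ω i ^ 2 ∂μ
        ≤ X := hM.x₀_le i
    linarith [sq_nonneg θ]
  | succ t ih =>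
    have hexp : 1 ≤ Real.exp (c * ∑ s ∈ Finset.range t, a s ^ 2) :=
      Real.one_le_exp (mul_nonneg hc0 (Finset.sum_nonneg fun s _ => sq_nonneg _))
    have hZ : X + θ ^ 2 + 1
        ≤ secondMomentBound θ ds dr H V W X q (∑ s ∈ Finset.range t, a s ^ 2) :=
      le_mul_of_one_le_right (by positivity) hexp
    have hχ : 0 ≤ G.measuringIndicator t i ∧ G.measuringIndicator t i ≤ 1 := by
      rw [measuringIndicator]
      split_ifs <;> norm_num
    simp only [sensorEstimate_succ]
    calc _ ≤ (1 + c * a t ^ 2)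
            * secondMomentBound θ ds dr H V W X q (∑ s ∈ Finset.range t, a s ^ 2) :=
          (nonanticipating_sensorEstimate θ a _ _ t h3 h4 h0 hw).integral_step_sq_le hG h3 h4
            (hw t) (hw0 t) hM (hcard t _) (ha t) hχ.1 hχ.2 (by nlinarith) (by nlinarith) ih
      _ ≤ Real.exp (c * a t ^ 2)
            * secondMomentBound θ ds dr H V W X q (∑ s ∈ Finset.range t, a s ^ 2) :=
          mul_le_mul_of_nonneg_right ((add_comm _ _).trans_le (Real.add_one_le_exp _))
            ((by positivity : 0 ≤ X + θ ^ 2 + 1).trans hZ)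
      _ = secondMomentBound θ ds dr H V W X q (∑ s ∈ Finset.range (t + 1), a s ^ 2) := by
          rw [secondMomentBound, secondMomentBound, Finset.sum_range_succ, mul_add, Real.exp_add]
          ring

theorem integral_sensorEstimate_sq_le_tsum (hG : G.ScalingConstants ds dr)
    (hq : G.IdleRelayBound q) (h3 : G.Assumption3 μ hbar) (h4 : G.Assumption4 μ)
    (h0 : G.AdmissibleInit μ) (hw : ∀ t i, MemLp (G.w t i) 2 μ)
    (hw0 : ∀ t i, ∫ ω, G.w t i ω ∂μ = 0) (hM : G.MomentBounds μ H V W X) (ha : ∀ t, 0 ≤ a t)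
    (hsum : Summable fun t => a t ^ 2) (i : Fin M) :
    ∫ ω, G.sensorEstimate θ a (scalingRule M K ds dr) (G.weight ds dr hbar) t ω i ^ 2 ∂μ
      ≤ secondMomentBound θ ds dr H V W X q (∑' s, a s ^ 2) :=
  (integral_sensorEstimate_sq_le θ a t hG hq h3 h4 h0 hw hw0 hM ha i).trans
    (secondMomentBound_mono hG hM i (hsum.sum_le_tsum _ fun _ _ => sq_nonneg _))

end SensorEstimate

section Power

variable {M K : ℕ} {Ω : Type u} [MeasurableSpace Ω] {G : RelayNetwork M K Ω} {μ : Measure Ω}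
  {hbar : Node M K → Node M K → ℝ} {ds dr H V W X Q κ θ : ℝ}
  {a : ℕ → ℝ} {b : ℕ → Fin M → ℝ} {t : ℕ}

theorem transmitPower_inl_le (hG : G.ScalingConstants ds dr)
    (hQ : ∀ k, ∫ ω, G.sensorEstimate θ a (scalingRule M K ds dr) b t ω k ^ 2 ∂μ ≤ Q)
    (i : Fin M) :
    G.transmitPower μ θ a (scalingRule M K ds dr) b t (Sum.inl i) ≤ Q / ds :=
  hG.sensorPower_le (hQ i)

variable [IsProbabilityMeasure μ]
  (hx : G.Nonanticipating μ t (G.sensorEstimate θ a (scalingRule M K ds dr) b t))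
  (hG : G.ScalingConstants ds dr) (h3 : G.Assumption3 μ hbar) (h4 : G.Assumption4 μ)
  (hM : G.MomentBounds μ H V W X)
  (hQ : ∀ k, ∫ ω, G.sensorEstimate θ a (scalingRule M K ds dr) b t ω k ^ 2 ∂μ ≤ Q)
include hx hG h3 h4 hM hQ

theorem transmitPower_inr_le (hQ0 : 0 ≤ Q) (j : Fin K) {c : ℝ}
    (hc : ((G.sensorNbr t (Sum.inr j)).card : ℝ) ^ 2 ≤ c) :
    G.transmitPower μ θ a (scalingRule M K ds dr) b t (Sum.inr j) ≤ c / dr * (H * Q + V) := by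
  have hdr := hG.dr_pos
  have hH := hM.h_nonneg (Sum.inr j)
  have hV := hM.v_nonneg (Sum.inr j)
  exact (hx.relayPower_le hG h3 h4 hM hQ j).trans (by gcongr)

theorem transmitPower_le (hQ0 : 0 ≤ Q) (i : Node M K) :
    G.transmitPower μ θ a (scalingRule M K ds dr) b t i
      ≤ max (Q / ds) (ds ^ 2 / dr * (H * Q + V)) := by
  obtain i | j := i
  · exact (transmitPower_inl_le hG hQ i).trans (le_max_left _ _)
  · exact (transmitPower_inr_le hx hG h3 h4 hM hQ hQ0 j
      (pow_le_pow_left₀ (Nat.cast_nonneg _) (hG.le_ds t _) 2)).trans (le_max_right _ _)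

theorem receivedPower_le (hQ0 : 0 ≤ Q) (hκ : 0 ≤ κ) (i : Node M K) :
    G.receivedPower μ κ θ a (scalingRule M K ds dr) b t i ≤ κ * (Q + (H * Q + V)) :=
  mul_le_mul_of_nonneg_left (hx.sum_power_le hG h3 h4 hM hQ hQ0 i) hκ

end Power

end RelayNetwork

open RelayNetwork in
theorem proposition5_general :
    (∀ (M K : ℕ) (Ω : Type u) [MeasurableSpace Ω] (μ : Measure Ω) [IsProbabilityMeasure μ]
        (G : RelayNetwork M K Ω) (hbar : Node M K → Node M K → ℝ) (ds dr : ℝ),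
        0 < ds → 0 < dr → G.Assumption3 μ hbar →
        ∀ (t : ℕ) (i j : Fin M),
          Integrable (fun ω => G.Gam (scalingRule M K ds dr) (G.weight ds dr hbar) t ω i j) μ ∧
          ∫ ω, G.Gam (scalingRule M K ds dr) (G.weight ds dr hbar) t ω i j ∂μ = 0) ∧
    (∀ (θ κ ds dr H V W X : ℝ) (a : ℕ → ℝ) (q : ℕ),
        (∀ t, 0 ≤ a t) → (Summable fun t => a t ^ 2) → 0 ≤ κ →
        ∃ C : ℝ,
        ∀ (M K : ℕ) [Nonempty (Fin M)] (Ω : Type u) [MeasurableSpace Ω] (μ : Measure Ω)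
          [IsProbabilityMeasure μ] (G : RelayNetwork M K Ω) (hbar : Node M K → Node M K → ℝ),
          G.ScalingConstants ds dr →
          (∀ t i, MemLp (G.w t i) 2 μ) → (∀ t i, ∫ ω, G.w t i ω ∂μ = 0) →
          G.Assumption3 μ hbar → G.Assumption4 μ →
          G.AdmissibleInit μ → G.MomentBounds μ H V W X → G.IdleRelayBound q →
          ∀ t : ℕ,
            (∀ i : Node M K,
              MemLp (G.estimate θ a (scalingRule M K ds dr) (G.weight ds dr hbar) t i) 2 μ ∧
              G.transmitPower μ θ a (scalingRule M K ds dr) (G.weight ds dr hbar) t i ≤ C ∧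
              G.receivedPower μ κ θ a (scalingRule M K ds dr) (G.weight ds dr hbar) t i ≤ C) ∧
            (∀ Q : ℝ,
              (∀ j : Fin M, ∫ ω, G.estimate θ a (scalingRule M K ds dr)
                (G.weight ds dr hbar) t (Sum.inl j) ω ^ 2 ∂μ ≤ Q) →
              (∀ i : Fin M, G.transmitPower μ θ a (scalingRule M K ds dr)
                (G.weight ds dr hbar) t (Sum.inl i) ≤ Q / ds) ∧
              (∀ j : Fin K, (∃ i : Fin M, (G.relayNbr t (Sum.inl i)).Nonempty) →
                G.transmitPower μ θ a (scalingRule M K ds dr)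
                  (G.weight ds dr hbar) t (Sum.inr j) ≤ H * Q + V) ∧
              (∀ i : Node M K, G.receivedPower μ κ θ a (scalingRule M K ds dr)
                (G.weight ds dr hbar) t i ≤ κ * (Q + (H * Q + V))))) := by
  refine ⟨fun M K Ω _ μ _ G hbar ds dr hds hdr h3 =>
    h3.integrable_and_integral_Gam_scalingRule hds.le hdr.le,
    fun θ κ ds dr H V W X a q ha hsum hκ => ?_⟩
  let Q₀ := secondMomentBound θ ds dr H V W X q (∑' s, a s ^ 2)
  refine ⟨max (max (Q₀ / ds) (ds ^ 2 / dr * (H * Q₀ + V))) (κ * (Q₀ + (H * Q₀ + V))),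
    fun M K _ Ω _ μ _ G hbar hG hw hw0 h3 h4 h0 hM hq t => ?_⟩
  have hx := nonanticipating_sensorEstimate θ a (scalingRule M K ds dr)
    (G.weight ds dr hbar) t h3 h4 h0 hw
  have nonneg_of_bound {Q : ℝ} (hQ : ∀ k, ∫ ω, G.sensorEstimate θ a (scalingRule M K ds dr)
      (G.weight ds dr hbar) t ω k ^ 2 ∂μ ≤ Q) : 0 ≤ Q :=
    (integral_nonneg fun _ => sq_nonneg _).trans (hQ (Classical.arbitrary _))
  have hQ₀ : ∀ k, ∫ ω, G.sensorEstimate θ a (scalingRule M K ds dr)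
      (G.weight ds dr hbar) t ω k ^ 2 ∂μ ≤ Q₀ :=
    integral_sensorEstimate_sq_le_tsum θ a t hG hq h3 h4 h0 hw hw0 hM ha hsum
  refine ⟨fun i => ⟨hx.memLp_nodeState h3 h4 _ i, le_max_of_le_left
    (transmitPower_le hx hG h3 h4 hM hQ₀ (nonneg_of_bound hQ₀) i), le_max_of_le_right
    (receivedPower_le hx hG h3 h4 hM hQ₀ (nonneg_of_bound hQ₀) hκ i)⟩,
    fun Q hQ => ⟨transmitPower_inl_le hG hQ, fun j ⟨i, hi⟩ => ?_,
      receivedPower_le hx hG h3 h4 hM hQ (nonneg_of_bound hQ) hκ⟩⟩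
  simpa only [div_self hG.dr_pos.ne', one_mul] using
    transmitPower_inr_le hx hG h3 h4 hM hQ (nonneg_of_bound hQ) j
      (hG.card_sensorNbr_sq_le hi j)

theorem proposition5 :
    -- the uncertainty matrix has zero mean
    (∀ (M K : ℕ) (Ω : Type u) [MeasurableSpace Ω] (μ : Measure Ω) [IsProbabilityMeasure μ]
        (G : RelayNetwork M K Ω) (hbar : Node M K → Node M K → ℝ) (ds dr : ℝ),
        G.ScalingConstants ds dr → G.Assumption3 μ hbar →
        ∀ (t : ℕ) (i j : Fin M),
          Integrable (fun ω => G.Gam (scalingRule M K ds dr) (G.weight ds dr hbar) t ω i j) μ ∧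
          ∫ ω, G.Gam (scalingRule M K ds dr) (G.weight ds dr hbar) t ω i j ∂μ = 0) ∧
    -- the powers are bounded, with a bound that is chosen before the numbers of nodes
    (∀ (θ α a₀ κ ds dr H V W X : ℝ) (q : ℕ),
        1 / 2 < α → α ≤ 1 → 0 ≤ a₀ → 0 < κ → 0 < ds → 0 < dr →
        ∃ C : ℝ,
        ∀ (M K : ℕ) (Ω : Type u) [MeasurableSpace Ω] (μ : Measure Ω) [IsProbabilityMeasure μ]
          (G : RelayNetwork M K Ω) (hbar : Node M K → Node M K → ℝ),
          G.ScalingConstants ds dr →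
          G.Assumption1 μ → G.Assumption2 μ → G.Assumption3 μ hbar → G.Assumption4 μ →
          G.AdmissibleInit μ → G.MomentBounds μ H V W X → G.IdleRelayBound q →
          ∀ t : ℕ,
            (∀ i : Node M K,
              MemLp (G.estimate θ (powerWeight a₀ α) (scalingRule M K ds dr)
                (G.weight ds dr hbar) t i) 2 μ ∧
              G.transmitPower μ θ (powerWeight a₀ α) (scalingRule M K ds dr)
                (G.weight ds dr hbar) t i ≤ C ∧
              G.receivedPower μ κ θ (powerWeight a₀ α) (scalingRule M K ds dr)
                (G.weight ds dr hbar) t i ≤ C) ∧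
            -- the powers are controlled by the second moments of the sensor estimates alone,
            -- uniformly in the scaling constants as well
            (∀ Q : ℝ,
              (∀ j : Fin M, ∫ ω, G.estimate θ (powerWeight a₀ α) (scalingRule M K ds dr)
                (G.weight ds dr hbar) t (Sum.inl j) ω ^ 2 ∂μ ≤ Q) →
              (∀ i : Fin M, G.transmitPower μ θ (powerWeight a₀ α) (scalingRule M K ds dr)
                (G.weight ds dr hbar) t (Sum.inl i) ≤ Q / ds) ∧
              (∀ j : Fin K, (∃ i : Fin M, (G.relayNbr t (Sum.inl i)).Nonempty) →
                G.transmitPower μ θ (powerWeight a₀ α) (scalingRule M K ds dr)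
                  (G.weight ds dr hbar) t (Sum.inr j) ≤ H * Q + V) ∧
              (∀ i : Node M K, G.receivedPower μ κ θ (powerWeight a₀ α) (scalingRule M K ds dr)
                (G.weight ds dr hbar) t i ≤ κ * (Q + (H * Q + V))))) := by
  refine ⟨fun M K Ω _ μ _ G hbar ds dr hG =>
    proposition5_general.1 M K Ω μ G hbar ds dr hG.ds_pos hG.dr_pos, ?_⟩
  intro θ α a₀ κ ds dr H V W X q hα _ ha₀ hκ _ _
  obtain ⟨C, hC⟩ := proposition5_general.2 θ κ ds dr H V W X (powerWeight a₀ α) q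
    (powerWeight_nonneg ha₀ α) (summable_powerWeight_sq a₀ hα) hκ.le
  refine ⟨C, fun M K Ω _ μ _ G hbar hG _ h2 => ?_⟩
  have : Nonempty (Fin M) := by
    obtain ⟨_, -, hT⟩ := h2.measurements
    obtain ⟨_, -, -, i, -⟩ := hT 0
    exact ⟨i⟩
  exact hC M K Ω μ G hbar hG h2.memLp h2.mean
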